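/- Let $F$ be a finite field with $q$ elements and let $0<\alpha<1$. A probability distribution $\mu$ on $F$ is called *$\alpha$-dense* if $\mu(s+T)\le 1-\alpha$ for every proper additive subgroup $T\subsetneq F$ and every $s\in F$. **Theorem.** There are absolute constants $c,C,K>0$ such that the following holds. Let $F$ be any finite field, with $q$ elements, let $0<\alpha<1$, let $\mu$ be an $\alpha$-dense probability distribution on $F$, and let $A$ be a random $n\times n$ matrix whose entries are independent and distributed according to $\mu$, where $\alpha n\ge K\log n$. Then for every non-zero $t\in F$, $$\Bigl|\,\mathbb P(\det A=t)-q^{-1}\prod_{k=2}^{\infty}\bigl(1-q^{-k}\bigr)\Bigr|\le C\,e^{-c\alpha n}.$$ In particular, for each fixed $\alpha$ the estimate holds for all sufficiently large $n$ (depending only on $\alpha$), uniformly in $q$, $\mu$ and $t$, with absolute constants $c$ and $C$. -/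

import Mathlib

open MeasureTheory ProbabilityTheory

/-- A measure `μ` on an additive group is `α`-dense, `0 < α < 1`, if it gives mass at most `1 - α`
to every coset `s + T` of every proper additive subgroup `T`.
(For `T` the whole group the coset has mass `1`, so `T` has to be proper; `T = {0}` is allowed.) -/
def IsAlphaDense {F : Type*} [AddGroup F] [MeasurableSpace F] (α : ℝ) (μ : Measure F) : Prop :=
  0 < α ∧ α < 1 ∧
    ∀ T : AddSubgroup F, T ≠ ⊤ → ∀ s : F, μ.real ((fun y => s + y) '' (T : Set F)) ≤ 1 - α

/-- The entries of the random `n × n` matrix `A` are independent random variables, each of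
law `μ`. -/
structure HasIIDEntries {Ω F : Type*} [MeasurableSpace Ω] [MeasurableSpace F] {n : ℕ}
    (A : Ω → Matrix (Fin n) (Fin n) F) (μ : Measure F) (P : Measure Ω) : Prop where
  measurable_entry : ∀ i j, Measurable fun ω => A ω i j
  law_entry : ∀ i j, P.map (fun ω => A ω i j) = μ
  indep_entries : iIndepFun (fun (ij : Fin n × Fin n) ω => A ω ij.1 ij.2) P

/-- The infinite product `∏_{k ≥ 2} (1 - q^{-k})`, indexed by `k = m + 2`. -/
noncomputable def prodFromTwo (q : ℕ) : ℝ := ∏' m : ℕ, (1 - ((q : ℝ) ^ (m + 2))⁻¹)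

/-- The product defining `prodFromTwo` converges for `q ≥ 2`. -/
theorem multipliable_prodFromTwo {q : ℕ} (hq : 2 ≤ q) :
    Multipliable fun m : ℕ => (1 - ((q : ℝ) ^ (m + 2))⁻¹) := by
  have hq' : (2 : ℝ) ≤ q := by exact_mod_cast hq
  have h : Summable fun m : ℕ => -((q : ℝ) ^ (m + 2))⁻¹ := by
    have h1 : Summable fun m : ℕ => ((q : ℝ)⁻¹) ^ m :=
      summable_geometric_of_lt_one (by positivity) (inv_lt_one_of_one_lt₀ (by linarith))
    have h2 := ((summable_nat_add_iff 2).2 h1).neg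
    simpa [inv_pow] using h2
  simpa [sub_eq_add_neg] using Real.multipliable_one_add_of_summable h

/-!
# The distribution of the determinant of a random matrix over a finite field

Write `q = |F|` and let `p` be the law of the entries. Rows are exposed one by one. If `k` rows
`Y` of length `n` are linearly independent with common kernel `G` (`rowKer`, of dimension
`n - k`), the next row stays in their span exactly if it is orthogonal to `G`. A uniform row does so
with probability `1 / |G| = q ^ (-(n - k))`, and by orthogonality of characters the deviation for
the actual row is at most the `fourierError` of `G`, which is `1 / |G|` times the sum of
`∏ |p̂ (w i)|` over the non-zero `w ∈ G`. Once the expected Fourier error is exponentially small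
(`sum_fourierError_le`), the probability that the first `n - 1` rows are independent is close to
`∏ (1 - q ^ (-j))`, `2 ≤ j ≤ n`. The determinant is the inner product of the last row with the
cofactor vector, a non-zero element of the one-dimensional common kernel of the other rows, so it
takes each value `t ≠ 0` with conditional probability close to `1 / q`, with the same error term.

The Fourier transform is controlled by the defect `1 - |p̂|²`. It behaves like the square of a
seminorm (`defect_add_le`), and density of `p` says that its average over any non-trivial additive
image of a group is at least `α` (`sum_defect_ge`). Hence on a group of vectors that, apart from
`0`, have at least `m` non-zero coordinates, every non-trivial subgroup contains a vector of total
defect at least `α * m`. Well below it, a sublevel set that is not trivial must at least double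
in size when the level is multiplied by `16` (`card_sublevel_doubling`), for otherwise its
two-fold sums would form a subgroup of small total defect. Iterated, this yields
`fourierError_le_lazy`: the Fourier error of such a group `G` is a small multiple of the
probability that a lazy row, with entries of law `lazyWeight`, is orthogonal to `G`.

For `k ≥ n / 2` the expected Fourier error is split according to the common kernel `G`.

* `G` contains a sparse vector. This is unlikely by a union bound over the support `J` and over
  sets of at most `|J|` rows that determine the vectors of `G` supported in `J`
  (`prob_exists_sparse_le`).
* `G` has no sparse vectors, and a lazy row is orthogonal to `G` with probability much larger than
  `1 / |G|` and larger than some exponentially small quantity (`IsUnsaturated`). Exchanging some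
  of the actual rows for lazy ones makes this event much more likely, while the family obtained
  after the exchange still determines `G`; so such `G` are rare (`prob_rowKer_bad_le`).
* Otherwise each non-zero vector of `G` is orthogonal to an actual row with probability at most a
  constant multiple of `1 / q`, and the Fourier error is governed by the number of vectors of
  small total defect in `G`. There are few such vectors altogether (`card_structured_le`), and a
  first moment bound finishes the estimate.

For `k < n / 2` the bound `(1 - α) ^ (n - k)` for the probability that a row is orthogonal to a
space of dimension `n - k` (`prob_kills_le_pow`) is enough.
-/

/-! ### Finite probability weights -/

/-- A probability vector on a finite type. -/
structure IsProbVec {V : Type*} [Fintype V] (p : V → ℝ) : Prop where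
  nonneg : ∀ x, 0 ≤ p x
  sum_eq_one : ∑ x, p x = 1

/-- The weight of the outcome `x` for independent coordinates, each distributed according to `p`. -/
def prodWeight {κ V : Type*} [Fintype κ] (p : V → ℝ) (x : κ → V) : ℝ := ∏ i, p (x i)

open Classical in
/-- The probability of the event `S` under the weights `p`. -/
noncomputable def prob {V : Type*} [Fintype V] (p : V → ℝ) (S : V → Prop) : ℝ :=
  ∑ x, if S x then p x else 0

section Weights

variable {κ V : Type*} [Fintype κ] [DecidableEq κ] [Fintype V] {p : V → ℝ}

theorem sum_prodWeight_mul_prod {R : Type*} [CommSemiring R] [Algebra ℝ R]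
    (p : V → ℝ) (f : κ → V → R) :
    ∑ x : κ → V, algebraMap ℝ R (prodWeight p x) * ∏ i, f i (x i) =
      ∏ i, ∑ y, algebraMap ℝ R (p y) * f i y := by
  rw [Finset.prod_univ_sum, Fintype.piFinset_univ]
  simp [prodWeight, Finset.prod_mul_distrib]

theorem IsProbVec.prodWeight (hp : IsProbVec p) :
    IsProbVec (prodWeight p : (κ → V) → ℝ) := by
  classical
  refine ⟨fun x => Finset.prod_nonneg fun i _ => hp.nonneg _, ?_⟩
  have := sum_prodWeight_mul_prod (R := ℝ) (κ := κ) p (fun _ _ => 1)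
  simpa [hp.sum_eq_one] using this

theorem prob_nonneg (hp : IsProbVec p) (S : V → Prop) : 0 ≤ prob p S :=
  Finset.sum_nonneg fun x _ => by split_ifs <;> simp [hp.nonneg]

theorem prob_mono (hp : IsProbVec p) {S T : V → Prop} (h : ∀ x, S x → T x) :
    prob p S ≤ prob p T := by
  refine Finset.sum_le_sum fun x _ => ?_
  by_cases hS : S x
  · simp [hS, h x hS]
  · by_cases hT : T x <;> simp [hS, hT, hp.nonneg]

theorem prob_true (hp : IsProbVec p) : prob p (fun _ => True) = 1 := by
  simp [prob, hp.sum_eq_one]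

theorem prob_le_one (hp : IsProbVec p) (S : V → Prop) : prob p S ≤ 1 :=
  prob_true hp ▸ prob_mono hp fun _ _ => trivial

theorem prob_not (hp : IsProbVec p) (S : V → Prop) : prob p (fun x => ¬ S x) = 1 - prob p S := by
  rw [eq_sub_iff_add_eq, ← hp.sum_eq_one, prob, prob, ← Finset.sum_add_distrib]
  refine Finset.sum_congr rfl fun x _ => ?_
  by_cases h : S x <;> simp [h]

theorem prob_exists_le (hp : IsProbVec p) {β : Type*} (s : Finset β) (S : β → V → Prop) :
    prob p (fun x => ∃ b ∈ s, S b x) ≤ ∑ b ∈ s, prob p (S b) := by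
  classical
  unfold prob
  rw [Finset.sum_comm]
  refine Finset.sum_le_sum fun x _ => ?_
  have hnn : ∀ b ∈ s, 0 ≤ if S b x then p x else 0 := fun b _ => by
    split_ifs <;> simp [hp.nonneg]
  split_ifs with h
  · obtain ⟨b, hb, hS⟩ := h
    calc p x = if S b x then p x else 0 := by simp [hS]
      _ ≤ _ := Finset.single_le_sum hnn hb
  · exact Finset.sum_nonneg hnn

theorem prob_eq_sum_mul (p : V → ℝ) (S : V → Prop) [DecidablePred S] :
    prob p S = ∑ x, p x * (if S x then 1 else 0) := by
  unfold prob
  refine Finset.sum_congr rfl fun x _ => ?_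
  by_cases h : S x <;> simp [h]

theorem prob_forall (p : V → ℝ) (S : V → Prop) :
    prob (prodWeight p : (κ → V) → ℝ) (fun x => ∀ j, S (x j)) = prob p S ^ Fintype.card κ := by
  classical
  have := sum_prodWeight_mul_prod (R := ℝ) (κ := κ) p (fun _ y => if S y then 1 else 0)
  rw [prob_eq_sum_mul, prob_eq_sum_mul]
  simp only [Algebra.algebraMap_self, RingHom.id_apply, Finset.prod_const, Finset.card_univ]
    at this
  rw [← this]
  refine Finset.sum_congr rfl fun x _ => ?_
  congr 1
  by_cases h : ∀ j, S (x j)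
  · simp [h]
  · push Not at h
    obtain ⟨j, hj⟩ := h
    rw [if_neg (fun h => hj (h j)), Finset.prod_eq_zero (Finset.mem_univ j) (by simp [hj])]

/-- Independence of two complementary blocks of coordinates. -/
theorem sum_prodWeight_split (p : V → ℝ) (I : κ → Prop) [DecidablePred I]
    [hI : Fintype {j // I j}] [hI' : Fintype {j // ¬ I j}]
    (h : ({j // I j} → V) → ({j // ¬ I j} → V) → ℝ) :
    ∑ x : κ → V, prodWeight p x * h (fun j => x j) (fun j => x j) =
      ∑ y : {j // I j} → V, prodWeight p y * ∑ z : {j // ¬ I j} → V, prodWeight p z * h y z := by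
  obtain rfl : hI = Subtype.fintype I := Subsingleton.elim _ _
  obtain rfl : hI' = Subtype.fintype _ := Subsingleton.elim _ _
  rw [← (Equiv.piEquivPiSubtypeProd I (fun _ => V)).symm.sum_comp, Fintype.sum_prod_type]
  refine Finset.sum_congr rfl fun y _ => ?_
  rw [Finset.mul_sum]
  refine Finset.sum_congr rfl fun z _ => ?_
  have h1 : prodWeight p ((Equiv.piEquivPiSubtypeProd I (fun _ => V)).symm (y, z)) =
      prodWeight p y * prodWeight p z := by
    unfold prodWeight
    rw [← Fintype.prod_subtype_mul_prod_subtype I]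
    congr 1
    · refine Finset.prod_congr rfl fun j _ => ?_
      simp [Equiv.piEquivPiSubtypeProd, j.2]
    · refine Finset.prod_congr rfl fun j _ => ?_
      simp [Equiv.piEquivPiSubtypeProd, j.2]
  rw [h1, mul_assoc]
  congr 3
  · ext j; simp [Equiv.piEquivPiSubtypeProd, j.2]
  · ext j; simp [Equiv.piEquivPiSubtypeProd, j.2]

/-- Independence of the last of `k + 1` coordinates from the others. -/
theorem sum_prodWeight_snoc (p : V → ℝ) {k : ℕ} (h : (Fin (k + 1) → V) → ℝ) :
    ∑ x : Fin (k + 1) → V, prodWeight p x * h x =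
      ∑ y : Fin k → V, prodWeight p y * ∑ z : V, p z * h (Fin.snoc y z) := by
  rw [← (Fin.snocEquiv fun _ => V).sum_comp, Fintype.sum_prod_type, Finset.sum_comm]
  refine Finset.sum_congr rfl fun y _ => ?_
  rw [Finset.mul_sum]
  refine Finset.sum_congr rfl fun z _ => ?_
  have : prodWeight p (Fin.snoc y z : Fin (k + 1) → V) = prodWeight p y * p z := by
    simp [prodWeight, Fin.prod_univ_castSucc]
  simp only [Fin.snocEquiv, Equiv.coe_fn_mk]
  rw [← mul_assoc, this]

end Weights

/-! ### Fourier analysis of a weight on a finite field -/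

section Fourier

variable {F : Type*} [Field F] [Fintype F]

/-- The Fourier transform of the weight `p` with respect to the additive character `ψ`. -/
noncomputable def charFn (ψ : AddChar F ℂ) (p : F → ℝ) (x : F) : ℂ := ∑ y, (p y : ℂ) * ψ (x * y)

/-- The defect `1 - |p̂(x)|²` of the Fourier transform, written as an average over pairs. -/
noncomputable def defect (ψ : AddChar F ℂ) (p : F → ℝ) (x : F) : ℝ :=
  ∑ y, ∑ z, p y * p z * (1 - (ψ (x * (y - z))).re)

/-- The law of `b * (Y - Z)`, where `b` is a Bernoulli variable of mean `β` and `Y`, `Z` have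
law `p`, all independent. -/
noncomputable def lazyWeight [DecidableEq F] (β : ℝ) (p : F → ℝ) (x : F) : ℝ :=
  (1 - β) * (if x = 0 then 1 else 0) + β * ∑ z, p z * p (z + x)

variable {ψ : AddChar F ℂ} {p : F → ℝ}

theorem normSq_charFn (hp : IsProbVec p) (x : F) :
    ‖charFn ψ p x‖ ^ 2 = 1 - defect ψ p x := by
  have h1 : (1 - defect ψ p x : ℝ) = ∑ y, ∑ z, p y * p z * (ψ (x * (y - z))).re := by
    have : (1 : ℝ) = ∑ y, ∑ z, p y * p z := by
      simp [← Finset.mul_sum, hp.sum_eq_one]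
    unfold defect
    nth_rewrite 1 [this]
    rw [← Finset.sum_sub_distrib]
    refine Finset.sum_congr rfl fun y _ => ?_
    rw [← Finset.sum_sub_distrib]
    refine Finset.sum_congr rfl fun z _ => ?_
    ring
  have h2 : ((‖charFn ψ p x‖ ^ 2 : ℝ) : ℂ) = ∑ y, ∑ z, (p y * p z : ℝ) * ψ (x * (y - z)) := by
    push_cast
    rw [← Complex.mul_conj', charFn, map_sum, Finset.sum_mul_sum]
    refine Finset.sum_congr rfl fun y _ => Finset.sum_congr rfl fun z _ => ?_
    rw [map_mul (starRingEnd ℂ), Complex.conj_ofReal, ← AddChar.map_neg_eq_conj, mul_sub,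
      sub_eq_add_neg,
      AddChar.map_add_eq_mul]
    ring
  rw [h1]
  have h3 := congrArg Complex.re h2
  rw [Complex.ofReal_re] at h3
  rw [h3, Complex.re_sum]
  refine Finset.sum_congr rfl fun y _ => ?_
  rw [Complex.re_sum]
  refine Finset.sum_congr rfl fun z _ => ?_
  rw [Complex.re_ofReal_mul]

theorem re_addChar_le_one (x : F) : (ψ x).re ≤ 1 := by
  calc (ψ x).re ≤ ‖ψ x‖ := Complex.re_le_norm _
    _ = 1 := AddChar.norm_apply ψ x

theorem defect_nonneg (hp : IsProbVec p) (x : F) : 0 ≤ defect ψ p x :=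
  Finset.sum_nonneg fun y _ => Finset.sum_nonneg fun z _ =>
    mul_nonneg (mul_nonneg (hp.nonneg _) (hp.nonneg _))
      (by linarith [re_addChar_le_one (ψ := ψ) (x * (y - z))])

theorem defect_le_one (hp : IsProbVec p) (x : F) : defect ψ p x ≤ 1 := by
  have := normSq_charFn (ψ := ψ) hp x
  nlinarith [sq_nonneg ‖charFn ψ p x‖]

theorem defect_zero : defect ψ p 0 = 0 := by simp [defect]

theorem defect_neg (x : F) : defect ψ p (-x) = defect ψ p x := by
  unfold defect
  rw [Finset.sum_comm]
  refine Finset.sum_congr rfl fun y _ => Finset.sum_congr rfl fun z _ => ?_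
  rw [show -x * (z - y) = x * (y - z) by ring, mul_comm (p z)]

theorem norm_charFn_le (hp : IsProbVec p) (x : F) :
    ‖charFn ψ p x‖ ≤ Real.exp (-(defect ψ p x / 2)) := by
  have h1 := normSq_charFn (ψ := ψ) hp x
  have h2 := Real.add_one_le_exp (-(defect ψ p x))
  have h3 : Real.exp (-(defect ψ p x / 2)) ^ 2 = Real.exp (-defect ψ p x) := by
    rw [← Real.exp_nat_mul]; congr 1; push_cast; ring
  refine le_of_sq_le_sq ?_ (Real.exp_pos _).le
  rw [h1, h3]; linarith

/-- The defect is a squared seminorm up to the weights of the quadratic mean: the triangle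
inequality `|1 - zw| ≤ |1 - z| + |1 - w|` on the unit circle, squared and averaged. -/
theorem defect_add_le (hp : IsProbVec p) (x y : F) {i j : ℝ} (hi : 0 < i) (hj : 0 < j) :
    defect ψ p (x + y) ≤ (i + j) * (defect ψ p x / i + defect ψ p y / j) := by
  have key : ∀ a b : F, 1 - (ψ (a + b)).re ≤
      (i + j) * ((1 - (ψ a).re) / i + (1 - (ψ b).re) / j) := by
    intro a b
    have hn : ∀ c : F, (ψ c).re ^ 2 + (ψ c).im ^ 2 = 1 := fun c => by
      have := AddChar.norm_apply ψ c
      have h2 : ‖ψ c‖ ^ 2 = 1 := by rw [this]; norm_num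
      rw [Complex.sq_norm, Complex.normSq_apply] at h2
      nlinarith
    have ha := hn a
    have hb := hn b
    rw [AddChar.map_add_eq_mul, Complex.mul_re]
    set a1 := (ψ a).re; set a2 := (ψ a).im; set b1 := (ψ b).re; set b2 := (ψ b).im
    have e : (i + j) * ((1 - a1) / i + (1 - b1) / j) =
        (1 - a1) + (1 - b1) + (j / i * (1 - a1) + i / j * (1 - b1)) := by
      field_simp; ring
    rw [e]
    -- the mixed term: `|1 - z| |1 - w| ≤ ((j / i) |1 - z|² + (i / j) |1 - w|²) / 2`
    have hm : -(1 - a1) * (1 - b1) + a2 * b2 ≤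
        j / i * (1 - a1) + i / j * (1 - b1) := by
      have h4 : ((1 - a1) ^ 2 + a2 ^ 2) = 2 * (1 - a1) := by nlinarith
      have h5 : ((1 - b1) ^ 2 + b2 ^ 2) = 2 * (1 - b1) := by nlinarith
      set r := j / i with hr
      have hr0 : 0 < r := by positivity
      have hr' : i / j = r⁻¹ := by rw [hr, inv_div]
      rw [hr']
      have h6 : r⁻¹ * (1 - b1) = r⁻¹ * (((1 - b1) ^ 2 + b2 ^ 2) / 2) := by rw [h5]; ring
      have h7 : r * (1 - a1) = r * (((1 - a1) ^ 2 + a2 ^ 2) / 2) := by rw [h4]; ring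
      rw [h6, h7]
      have h8 : r * r⁻¹ = 1 := mul_inv_cancel₀ hr0.ne'
      have h9 : ∀ u v : ℝ, 2 * (u * v) ≤ r * u ^ 2 + r⁻¹ * v ^ 2 := fun u v => by
        have : r * u ^ 2 + r⁻¹ * v ^ 2 - 2 * (u * v) = r * (u - r⁻¹ * v) ^ 2 := by
          have : r * (u - r⁻¹ * v) ^ 2 = r * u ^ 2 - 2 * (r * r⁻¹) * (u * v) +
              (r * r⁻¹) * r⁻¹ * v ^ 2 := by ring
          rw [this, h8]; ring
        nlinarith [mul_nonneg hr0.le (sq_nonneg (u - r⁻¹ * v))]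
      have := h9 (-(1 - a1)) (1 - b1)
      have := h9 a2 b2
      nlinarith
    nlinarith
  have h1 : (i + j) * (defect ψ p x / i + defect ψ p y / j) = ∑ u, ∑ v, p u * p v *
      ((i + j) * ((1 - (ψ (x * (u - v))).re) / i + (1 - (ψ (y * (u - v))).re) / j)) := by
    unfold defect
    simp only [Finset.sum_div, ← Finset.sum_add_distrib, Finset.mul_sum]
    refine Finset.sum_congr rfl fun u _ => Finset.sum_congr rfl fun v _ => ?_
    ring
  rw [h1]
  refine Finset.sum_le_sum fun u _ => Finset.sum_le_sum fun v _ => ?_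
  rw [add_mul]
  exact mul_le_mul_of_nonneg_left (key _ _) (mul_nonneg (hp.nonneg _) (hp.nonneg _))

theorem lazyWeight_isProbVec [DecidableEq F] (hp : IsProbVec p) {β : ℝ} (h0 : 0 ≤ β) (h1 : β ≤ 1) :
    IsProbVec (lazyWeight β p) := by
  refine ⟨fun x => ?_, ?_⟩
  · have : 0 ≤ ∑ z, p z * p (z + x) :=
      Finset.sum_nonneg fun z _ => mul_nonneg (hp.nonneg _) (hp.nonneg _)
    have h2 : 0 ≤ (if x = 0 then (1 : ℝ) else 0) := by split_ifs <;> simp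
    have := mul_nonneg h0 this
    have := mul_nonneg (sub_nonneg.2 h1) h2
    unfold lazyWeight
    convert add_nonneg this ‹0 ≤ β * _›
  · simp only [lazyWeight, Finset.sum_add_distrib, ← Finset.mul_sum]
    rw [Finset.sum_comm]
    have : ∀ z, ∑ x, p z * p (z + x) = p z := fun z => by
      have h := Fintype.sum_equiv (Equiv.addLeft z) (fun x => p (z + x)) p (fun _ => rfl)
      rw [← Finset.mul_sum, h, hp.sum_eq_one, mul_one]
    simp [this, hp.sum_eq_one]

theorem charFn_lazyWeight [DecidableEq F] (hp : IsProbVec p) (β : ℝ) (x : F) :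
    charFn ψ (lazyWeight β p) x = ((1 - β * defect ψ p x : ℝ) : ℂ) := by
  have h1 : ((‖charFn ψ p x‖ ^ 2 : ℝ) : ℂ) = ∑ y, ∑ z, (p z * p (z + y) : ℝ) * ψ (x * y) := by
    push_cast
    rw [← Complex.mul_conj', charFn, map_sum, Finset.sum_mul_sum, Finset.sum_comm, Finset.sum_comm]
    rw [Finset.sum_comm]
    rw [Finset.sum_comm (s := Finset.univ) (t := Finset.univ)
      (f := fun y z => (p z : ℂ) * p (z + y) * ψ (x * y))]
    refine Finset.sum_congr rfl fun z _ => ?_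
    rw [← Equiv.sum_comp (Equiv.addLeft z)]
    refine Finset.sum_congr rfl fun y _ => ?_
    rw [map_mul (starRingEnd ℂ), Complex.conj_ofReal, ← AddChar.map_neg_eq_conj, Equiv.coe_addLeft]
    rw [show x * y = x * (z + y) + -(x * z) by ring, AddChar.map_add_eq_mul]
    ring
  have h2 : 1 - β * defect ψ p x = (1 - β) + β * ‖charFn ψ p x‖ ^ 2 := by
    rw [normSq_charFn hp]; ring
  rw [h2, Complex.ofReal_add, Complex.ofReal_mul, h1]
  unfold charFn lazyWeight
  push_cast
  simp only [add_mul, Finset.sum_add_distrib, Finset.mul_sum, Finset.sum_mul]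
  congr 1
  · rw [Finset.sum_eq_single 0 (fun y _ hy => by rw [if_neg hy]; simp) (by simp)]
    simp
  · refine Finset.sum_congr rfl fun y _ => Finset.sum_congr rfl fun z _ => ?_
    ring

theorem lazyWeight_le [DecidableEq F] (hp : IsProbVec p) {a β : ℝ} (hpa : ∀ x, p x ≤ 1 - a)
    (h0 : 0 ≤ β)
    (h1 : β ≤ 1 / 2) (x : F) : lazyWeight β p x ≤ 1 - β * a := by
  have h2 : ∑ z, p z * p (z + x) ≤ 1 - a := by
    calc ∑ z, p z * p (z + x) ≤ ∑ z, p z * (1 - a) :=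
          Finset.sum_le_sum fun z _ => mul_le_mul_of_nonneg_left (hpa _) (hp.nonneg _)
      _ = 1 - a := by rw [← Finset.sum_mul, hp.sum_eq_one, one_mul]
  have h4 := mul_le_mul_of_nonneg_left h2 h0
  unfold lazyWeight
  split_ifs <;> nlinarith

/-- Averaged over a non-trivial additive image of a finite group, the defect is at least `α`. -/
theorem sum_defect_ge (hp : IsProbVec p) (hψ : ψ ≠ 1) {α : ℝ}
    (hα : ∀ T : AddSubgroup F, T ≠ ⊤ → ∀ s, prob p (fun y => y - s ∈ T) ≤ 1 - α)
    {H : Type*} [AddCommGroup H] [Fintype H] (π : H →+ F) (hπ : ∃ h, π h ≠ 0) :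
    α * Fintype.card H ≤ ∑ h, defect ψ p (π h) := by
  classical
  let T : AddSubgroup F :=
    { carrier := {x | ∀ h, ψ (π h * x) = 1}
      zero_mem' := by simp
      add_mem' := by
        intro a b ha hb h
        rw [mul_add, AddChar.map_add_eq_mul, ha h, hb h, one_mul]
      neg_mem' := by
        intro a ha h
        rw [mul_neg, AddChar.map_neg_eq_inv, ha h, inv_one] }
  have hT : T ≠ ⊤ := by
    intro hT
    obtain ⟨h, hh⟩ := hπ
    apply hψ
    rw [AddChar.eq_one_iff]
    intro x
    have : (π h)⁻¹ * x ∈ T := hT ▸ AddSubgroup.mem_top _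
    have := this h
    rwa [← mul_assoc, mul_inv_cancel₀ hh, one_mul] at this
  have horth : ∀ x, ∑ h, (1 - (ψ (π h * x)).re) =
      if x ∈ T then 0 else (Fintype.card H : ℝ) := by
    intro x
    let χ : AddChar H ℂ := (ψ.compAddMonoidHom ((AddMonoidHom.mulRight x).comp π))
    have hχ : ∀ h, χ h = ψ (π h * x) := fun h => rfl
    have h1 : ∑ h, (ψ (π h * x)).re = (∑ h, χ h).re := by
      rw [Complex.re_sum]; rfl
    rw [Finset.sum_sub_distrib, h1, AddChar.sum_eq_ite]
    have h2 : χ = 0 ↔ x ∈ T := by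
      rw [AddChar.eq_zero_iff]; exact Iff.rfl
    by_cases hx : x ∈ T
    · simp [hx, h2.2 hx]
    · simp [hx, h2]
  have h3 : ∑ h, defect ψ p (π h) =
      ∑ z, p z * (Fintype.card H * ∑ y, if y - z ∈ T then 0 else p y) := by
    unfold defect
    rw [Finset.sum_comm]
    simp only [Finset.sum_comm (s := (Finset.univ : Finset H))]
    rw [Finset.sum_comm]
    refine Finset.sum_congr rfl fun z _ => ?_
    rw [Finset.mul_sum, Finset.mul_sum]
    refine Finset.sum_congr rfl fun y _ => ?_
    rw [← Finset.mul_sum, horth]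
    split_ifs <;> ring
  rw [h3]
  have h4 : ∀ z, α ≤ ∑ y, if y - z ∈ T then 0 else p y := by
    intro z
    have h5 := prob_not hp (fun y => y - z ∈ T)
    have h6 := hα T hT z
    have h7 : ∑ y, (if y - z ∈ T then 0 else p y) = prob p (fun y => ¬ (y - z ∈ T)) := by
      unfold prob
      refine Finset.sum_congr rfl fun y _ => ?_
      by_cases h : y - z ∈ T <;> simp [h]
    rw [h7, h5]; linarith
  calc α * Fintype.card H = ∑ z, p z * (Fintype.card H * α) := by
        rw [← Finset.sum_mul, hp.sum_eq_one]; ring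
    _ ≤ _ := Finset.sum_le_sum fun z _ => mul_le_mul_of_nonneg_left
        (mul_le_mul_of_nonneg_left (h4 z) (Nat.cast_nonneg _)) (hp.nonneg _)

end Fourier

/-! ### Growth of sublevel sets -/

/-- A function on an additive group that behaves like the square of a seminorm. -/
structure IsSquaredSeminorm {G : Type*} [AddCommGroup G] (S : G → ℝ) : Prop where
  nonneg : ∀ x, 0 ≤ S x
  map_zero : S 0 = 0
  map_neg : ∀ x, S (-x) = S x
  add_le : ∀ x y {i j : ℝ}, 0 < i → 0 < j → S (x + y) ≤ (i + j) * (S x / i + S y / j)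

/-- Every non-trivial subgroup contains a point where `S` is at least `M`. -/
def LargeOnSubgroups {G : Type*} [AddCommGroup G] (S : G → ℝ) (M : ℝ) : Prop :=
  ∀ H : AddSubgroup G, H ≠ ⊥ → ∃ h ∈ H, M ≤ S h

open Classical in
/-- The sublevel set `{S ≤ u}`. -/
noncomputable def sublevel {G : Type*} [Fintype G] (S : G → ℝ) (u : ℝ) : Finset G :=
  Finset.univ.filter fun x => S x ≤ u

section Growth

variable {G : Type*} [AddCommGroup G] [Fintype G] {S : G → ℝ}

omit [AddCommGroup G] in
theorem mem_sublevel {u : ℝ} {x : G} : x ∈ sublevel S u ↔ S x ≤ u := by simp [sublevel]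

omit [AddCommGroup G] in
theorem sublevel_mono {u v : ℝ} (h : u ≤ v) : sublevel S u ⊆ sublevel S v := fun _ hx =>
  mem_sublevel.2 ((mem_sublevel.1 hx).trans h)

omit [Fintype G] in
theorem IsSquaredSeminorm.add_le_sq (hS : IsSquaredSeminorm S) {x y : G} {i j u : ℝ}
    (hi : 0 < i) (hj : 0 < j) (hx : S x ≤ i ^ 2 * u) (hy : S y ≤ j ^ 2 * u) :
    S (x + y) ≤ (i + j) ^ 2 * u := by
  refine (hS.add_le x y hi hj).trans ?_
  have h1 : S x / i ≤ i * u := by rw [div_le_iff₀ hi]; linarith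
  have h2 : S y / j ≤ j * u := by rw [div_le_iff₀ hj]; linarith
  have := mul_le_mul_of_nonneg_left (add_le_add h1 h2) (add_pos hi hj).le
  linarith

/-- Either three-fold sums of the sublevel set `T = {S ≤ u}` are already two-fold sums, so that
`T + T` is a subgroup on which `S` is small, or some `x + T` is disjoint from `T`. -/
theorem card_sublevel_doubling (hS : IsSquaredSeminorm S) {M u : ℝ} (hM : LargeOnSubgroups S M)
    (hu : 0 ≤ u) (huM : 4 * u < M) :
    (∀ x ∈ sublevel S u, x = 0) ∨ 2 * (sublevel S u).card ≤ (sublevel S (16 * u)).card := by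
  classical
  by_cases hx : ∃ x, S x ≤ 9 * u ∧ ∀ a b, S a ≤ u → S b ≤ u → x ≠ a + b
  · right
    obtain ⟨x, hx, hab⟩ := hx
    have hdisj : Disjoint (sublevel S u) ((sublevel S u).image (x + ·)) := by
      rw [Finset.disjoint_left]
      intro t ht ht'
      obtain ⟨s, hs, rfl⟩ := Finset.mem_image.1 ht'
      exact hab (x + s) (-s) (mem_sublevel.1 ht) (hS.map_neg s ▸ mem_sublevel.1 hs) (by simp)
    have hsub : sublevel S u ∪ (sublevel S u).image (x + ·) ⊆ sublevel S (16 * u) := by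
      intro t ht
      rcases Finset.mem_union.1 ht with ht | ht
      · exact mem_sublevel.2 ((mem_sublevel.1 ht).trans (by linarith))
      · obtain ⟨s, hs, rfl⟩ := Finset.mem_image.1 ht
        have := hS.add_le_sq (x := x) (y := s) (i := 3) (j := 1) (u := u) (by norm_num)
          (by norm_num) (by linarith) (by linarith [mem_sublevel.1 hs])
        exact mem_sublevel.2 (by linarith)
    have := Finset.card_le_card hsub
    rw [Finset.card_union_of_disjoint hdisj, Finset.card_image_of_injective _
      (add_right_injective x)] at this
    omega
  · left
    push Not at hx
    have h0 : S 0 ≤ u := hS.map_zero.trans_le hu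
    have h3 : ∀ a b c, S a ≤ u → S b ≤ u → S c ≤ u →
        ∃ a' b', S a' ≤ u ∧ S b' ≤ u ∧ a + b + c = a' + b' := by
      intro a b c ha hb hc
      have h1 := hS.add_le_sq (x := a) (y := b) (i := 1) (j := 1) (u := u) (by norm_num)
          (by norm_num) (by linarith) (by linarith)
      have h2 := hS.add_le_sq (x := a + b) (y := c) (i := 2) (j := 1) (u := u) (by norm_num)
          (by norm_num) (by linarith) (by linarith)
      exact hx (a + b + c) (by linarith)
    -- `S ≤ 9 * u` on three-fold sums of `T`, so they are two-fold sums and `T + T` is closed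
    let H : AddSubgroup G :=
      { carrier := {x | ∃ a b, S a ≤ u ∧ S b ≤ u ∧ x = a + b}
        zero_mem' := ⟨0, 0, h0, h0, by simp⟩
        add_mem' := by
          rintro _ _ ⟨a, b, ha, hb, rfl⟩ ⟨c, d, hc, hd, rfl⟩
          obtain ⟨a', b', ha', hb', h⟩ := h3 a b c ha hb hc
          obtain ⟨a₂, b₂, ha₂, hb₂, h'⟩ := h3 a' b' d ha' hb' hd
          exact ⟨a₂, b₂, ha₂, hb₂, by rw [← h', ← h]; abel⟩
        neg_mem' := by
          rintro _ ⟨a, b, ha, hb, rfl⟩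
          exact ⟨-a, -b, by rwa [hS.map_neg], by rwa [hS.map_neg], by abel⟩ }
    intro t ht
    by_contra ht0
    have hH : H ≠ ⊥ := by
      intro hH
      have : t ∈ H := ⟨t, 0, mem_sublevel.1 ht, h0, by simp⟩
      rw [hH] at this
      exact ht0 this
    obtain ⟨_, ⟨a, b, ha, hb, rfl⟩, hMS⟩ := hM H hH
    have h1 := hS.add_le_sq (x := a) (y := b) (i := 1) (j := 1) (u := u) (by norm_num)
      (by norm_num) (by linarith) (by linarith)
    linarith

theorem card_sublevel_growth (hS : IsSquaredSeminorm S) {M u : ℝ} (hM : LargeOnSubgroups S M)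
    (hM0 : 0 < M) (hu : 0 ≤ u) (j : ℕ) (huM : 16 ^ j * u ≤ M) :
    (∀ x ∈ sublevel S u, x = 0) ∨ 2 ^ j * (sublevel S u).card ≤ (sublevel S (16 ^ j * u)).card := by
  induction j with
  | zero => right; simp
  | succ j ih =>
    rw [pow_succ] at huM
    have hnn : 0 ≤ 16 ^ j * u := by positivity
    rcases ih (by nlinarith) with h | h
    · exact Or.inl h
    · rcases card_sublevel_doubling hS hM hnn (by linarith) with h' | h'
      · left
        intro x hx
        refine h' x (sublevel_mono ?_ hx)
        have : (1 : ℝ) ≤ 16 ^ j := one_le_pow₀ (by norm_num)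
        nlinarith
      · right
        rw [show (16 : ℝ) ^ (j + 1) * u = 16 * (16 ^ j * u) by ring, pow_succ]
        linarith

theorem card_sublevel_le_half [Nontrivial G] (hS : IsSquaredSeminorm S) {M u : ℝ}
    (hM : LargeOnSubgroups S M) (huM : 4 * u < M) :
    2 * (sublevel S u).card ≤ Fintype.card G := by
  classical
  by_contra hlt
  push Not at hlt
  obtain ⟨h, -, hh⟩ := hM ⊤ (by simp)
  have hcard : ((sublevel S u).image (h - ·)).card = (sublevel S u).card :=
    Finset.card_image_of_injective _ sub_right_injective
  have : ¬ Disjoint (sublevel S u) ((sublevel S u).image (h - ·)) := by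
    intro hd
    have := Finset.card_le_univ (sublevel S u ∪ (sublevel S u).image (h - ·))
    rw [Finset.card_union_of_disjoint hd, hcard] at this
    omega
  rw [Finset.not_disjoint_iff] at this
  obtain ⟨a, ha, ha'⟩ := this
  obtain ⟨b, hb, rfl⟩ := Finset.mem_image.1 ha'
  have h1 := hS.add_le_sq (x := h - b) (y := b) (i := 1) (j := 1) (u := u) (by norm_num)
    (by norm_num) (by linarith [mem_sublevel.1 ha]) (by linarith [mem_sublevel.1 hb])
  rw [sub_add_cancel] at h1
  linarith

theorem sum_exp_le_half [Nontrivial G] (hS : IsSquaredSeminorm S) {M : ℝ}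
    (hM : LargeOnSubgroups S M) (hM0 : 0 < M) :
    ∑ w, Real.exp (-(S w / 2)) ≤ Fintype.card G * (1 / 2 + 1 / 2 * Real.exp (-(M / 10))) := by
  classical
  have h1 := card_sublevel_le_half hS hM (u := M / 5) (by linarith)
  have h2 : ∀ w, Real.exp (-(S w / 2)) ≤ Real.exp (-(M / 10)) +
      if w ∈ sublevel S (M / 5) then (1 - Real.exp (-(M / 10))) else 0 := by
    intro w
    split_ifs with h
    · have := Real.exp_le_one_iff.2 (show -(S w / 2) ≤ 0 by linarith [hS.nonneg w])
      linarith
    · rw [mem_sublevel, not_le] at h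
      rw [add_zero]
      exact Real.exp_le_exp.2 (by linarith)
  refine (Finset.sum_le_sum fun w _ => h2 w).trans ?_
  rw [Finset.sum_add_distrib, Finset.sum_ite_mem]
  simp only [Finset.sum_const, Finset.card_univ, nsmul_eq_mul, Finset.univ_inter]
  have h3 : (2 : ℝ) * (sublevel S (M / 5)).card ≤ Fintype.card G := by exact_mod_cast h1
  have h4 : Real.exp (-(M / 10)) ≤ 1 := Real.exp_le_one_iff.2 (by linarith)
  nlinarith

omit [AddCommGroup G] [Fintype G] in
theorem sum_indicator_exp_eq (s : Finset G) (a : G → ℝ) (u : ℝ) :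
    ∑ x ∈ s, (Set.Ici (a x)).indicator (fun u : ℝ => Real.exp (-u)) u =
      (s.filter fun x => a x ≤ u).card * Real.exp (-u) := by
  rw [Finset.card_filter]
  push_cast
  rw [Finset.sum_mul]
  refine Finset.sum_congr rfl fun x _ => ?_
  by_cases hx : a x ≤ u <;> simp [Set.indicator, hx]

/-- Layer-cake comparison of exponential sums. -/
theorem sum_exp_le_of_card_le {A B : Type*} (s : Finset A) (t : Finset B) (a : A → ℝ)
    (b : B → ℝ) {c : ℝ}
    (h : ∀ u, c * (s.filter fun x => a x ≤ u).card ≤ (t.filter fun x => b x ≤ u).card) :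
    c * ∑ x ∈ s, Real.exp (-(a x)) ≤ ∑ x ∈ t, Real.exp (-(b x)) := by
  have hval : ∀ v : ℝ, ∫ u, (Set.Ici v).indicator (fun u : ℝ => Real.exp (-u)) u =
      Real.exp (-v) := fun v => by
    rw [integral_indicator measurableSet_Ici, integral_Ici_eq_integral_Ioi, integral_exp_neg_Ioi]
  have hint : ∀ v : ℝ, Integrable ((Set.Ici v).indicator fun u : ℝ => Real.exp (-u)) := fun v =>
    (integrable_indicator_iff measurableSet_Ici).2 (by
      rw [integrableOn_Ici_iff_integrableOn_Ioi]; exact integrableOn_exp_neg_Ioi v)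
  rw [Finset.sum_congr rfl fun x _ => (hval (a x)).symm,
    Finset.sum_congr rfl fun x _ => (hval (b x)).symm,
    ← integral_finsetSum _ fun x _ => hint _, ← integral_finsetSum _ fun x _ => hint _,
    ← integral_const_mul]
  refine integral_mono ((integrable_finsetSum _ fun x _ => hint _).const_mul _)
    (integrable_finsetSum _ fun x _ => hint _) fun u => ?_
  simp only [sum_indicator_exp_eq]
  rw [← mul_assoc]
  exact mul_le_mul_of_nonneg_right (h u) (Real.exp_pos _).le

/-- The comparison behind the exponential gain: the non-trivial part of the sum of `exp (-S / 2)`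
is at most a small multiple of the full sum of the flatter `exp (-S / (2 * 16 ^ j))`. -/
theorem sum_exp_ne_zero_le [DecidableEq G] (hS : IsSquaredSeminorm S) {M : ℝ}
    (hM : LargeOnSubgroups S M) (hM0 : 0 < M) (j : ℕ) :
    ∑ w ∈ Finset.univ.erase 0, Real.exp (-(S w / 2)) ≤
      (2 ^ j)⁻¹ * ∑ w, Real.exp (-(S w / (2 * 16 ^ j))) +
        Real.exp (-(M / 16 ^ j / 4)) * ∑ w, Real.exp (-(S w / 4)) := by
  classical
  set N : ℝ := 16 ^ j with hN
  have hN0 : 0 < N := by positivity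
  set s : Finset G := (Finset.univ.erase 0).filter fun w => S w ≤ M / N
  -- below the level `M / 16 ^ j` the sublevel sets grow; above it half of the exponent is given up
  have h1 : (2 ^ j : ℝ) * ∑ w ∈ s, Real.exp (-(S w / 2)) ≤
      ∑ w, Real.exp (-(S w / (2 * N))) := by
    refine sum_exp_le_of_card_le s Finset.univ _ _ fun v => ?_
    set v' := min (2 * v) (M / N)
    have hsub : (s.filter fun w => S w / 2 ≤ v) ⊆ sublevel S v' := by
      intro w hw
      simp only [s, Finset.mem_filter] at hw
      exact mem_sublevel.2 (le_min (by linarith [hw.2]) hw.1.2)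
    have hne : ∀ w ∈ (s.filter fun w => S w / 2 ≤ v), w ≠ 0 := by
      intro w hw
      simp only [s, Finset.mem_filter, Finset.mem_erase] at hw
      exact hw.1.1.1
    rcases (s.filter fun w => S w / 2 ≤ v).eq_empty_or_nonempty with he | ⟨w, hw⟩
    · rw [he]; simp
    · have hv' : 0 ≤ v' := (hS.nonneg w).trans (mem_sublevel.1 (hsub hw))
      have hNv : N * v' ≤ M := by
        have : v' ≤ M / N := min_le_right _ _
        rw [le_div_iff₀ hN0] at this
        linarith
      rcases card_sublevel_growth hS hM hM0 hv' j hNv with h | h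
      · exact absurd (h w (hsub hw)) (hne w hw)
      · have h2 : sublevel S (N * v') ⊆ Finset.univ.filter fun w => S w / (2 * N) ≤ v := by
          intro x hx
          have h3 := mem_sublevel.1 hx
          simp only [Finset.mem_filter, Finset.mem_univ, true_and]
          rw [div_le_iff₀ (by positivity)]
          have : v' ≤ 2 * v := min_le_left _ _
          nlinarith
        have h4 := (Nat.mul_le_mul_left (2 ^ j) (Finset.card_le_card hsub)).trans
          (h.trans (Finset.card_le_card h2))
        exact_mod_cast h4
  have h2 : ∑ w ∈ (Finset.univ.erase 0).filter (fun w => ¬ S w ≤ M / N),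
      Real.exp (-(S w / 2)) ≤ Real.exp (-(M / N / 4)) * ∑ w, Real.exp (-(S w / 4)) := by
    rw [Finset.mul_sum]
    refine (Finset.sum_le_sum (g := fun w => Real.exp (-(M / N / 4)) * Real.exp (-(S w / 4)))
      fun w hw => ?_).trans (Finset.sum_le_sum_of_subset_of_nonneg (Finset.subset_univ _)
        fun _ _ _ => by positivity)
    have := (Finset.mem_filter.1 hw).2
    rw [← Real.exp_add]
    exact Real.exp_le_exp.2 (by linarith)
  rw [← Finset.sum_filter_add_sum_filter_not _ (fun w => S w ≤ M / N)]
  refine add_le_add ?_ h2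
  rw [← div_eq_inv_mul, le_div_iff₀' (by positivity)]
  exact h1

end Growth

/-! ### Rows orthogonal to a subspace -/

/-- The weight form of `α`-density: every coset of a proper additive subgroup has mass at most
`1 - α`. -/
def DenseWeight {F : Type*} [AddGroup F] [Fintype F] (α : ℝ) (p : F → ℝ) : Prop :=
  ∀ T : AddSubgroup F, T ≠ ⊤ → ∀ s, prob p (fun y => y - s ∈ T) ≤ 1 - α

/-- The vector `x` is orthogonal to the subspace `G`. -/
def Kills {ι F : Type*} [Fintype ι] [Field F] (x : ι → F) (G : Submodule F (ι → F)) : Prop :=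
  ∀ w ∈ G, x ⬝ᵥ w = 0

/-- The total defect of the Fourier transform of a random vector with independent coordinates. -/
noncomputable def totalDefect {ι F : Type*} [Fintype ι] [Field F] [Fintype F] (ψ : AddChar F ℂ)
    (p : F → ℝ) (w : ι → F) : ℝ :=
  ∑ i, defect ψ p (w i)

open Classical in
/-- The average over `G` of the absolute values of the Fourier transform of a random row, without
the contribution `1` of the zero vector. It bounds the distance of the probability that the row is
orthogonal to `G` from its value `1 / |G|` for a uniformly distributed row. -/
noncomputable def fourierError {ι F : Type*} [Fintype ι] [DecidableEq ι] [Field F] [Fintype F]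
    (ψ : AddChar F ℂ) (p : F → ℝ) (G : Submodule F (ι → F)) : ℝ :=
  (Nat.card G : ℝ)⁻¹ * (∑ w : G, ∏ i, ‖charFn ψ p (w.1 i)‖ - 1)

section Rows

variable {ι F : Type*} [Fintype ι] [DecidableEq ι] [Field F] [Fintype F] [DecidableEq F]
  {ψ : AddChar F ℂ} {p : F → ℝ}

omit [DecidableEq ι] [DecidableEq F] in
theorem isSquaredSeminorm_totalDefect (hp : IsProbVec p) {G : Type*} [AddCommGroup G]
    (π : G →+ (ι → F)) : IsSquaredSeminorm fun g => totalDefect ψ p (π g) where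
  nonneg g := Finset.sum_nonneg fun i _ => defect_nonneg hp _
  map_zero := by simp [totalDefect, defect_zero]
  map_neg g := by simp [totalDefect, defect_neg]
  add_le x y i j hi hj := by
    simp only [totalDefect, Finset.sum_div, ← Finset.sum_add_distrib, Finset.mul_sum, map_add]
    exact Finset.sum_le_sum fun k _ => defect_add_le hp _ _ hi hj

omit [DecidableEq ι] in
/-- On a group of vectors with at least `m` non-zero coordinates, no non-trivial subgroup has all
its total defects below `α * m`: the average over the subgroup is at least that large. -/
theorem largeOnSubgroups_totalDefect (hp : IsProbVec p) (hψ : ψ ≠ 1) {α m : ℝ} (hα0 : 0 ≤ α)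
    (hα : DenseWeight α p) {G : Type*} [AddCommGroup G] [Finite G] (π : G →+ (ι → F))
    (hm : ∀ g, g ≠ 0 → m ≤ hammingNorm (π g)) :
    LargeOnSubgroups (fun g => totalDefect ψ p (π g)) (α * m) := by
  classical
  intro H hH
  obtain ⟨g, hg, hg0⟩ := (AddSubgroup.bot_or_exists_ne_zero H).resolve_left hH
  by_contra hlt
  push Not at hlt
  have : Fintype H := Fintype.ofFinite H
  have h1 : ∑ h : H, totalDefect ψ p (π h) < ∑ _h : H, α * m :=
    Finset.sum_lt_sum_of_nonempty ⟨0, Finset.mem_univ _⟩ fun h _ => hlt h h.2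
  have h2 : ∑ h : H, totalDefect ψ p (π h) ≥
      ∑ i ∈ Finset.univ.filter (fun i => π g i ≠ 0), α * Fintype.card H := by
    unfold totalDefect
    rw [Finset.sum_comm]
    refine le_trans (Finset.sum_le_sum fun i hi => ?_) (Finset.sum_le_sum_of_subset_of_nonneg
      (Finset.subset_univ _) fun i _ _ => Finset.sum_nonneg fun h _ => defect_nonneg hp _)
    exact sum_defect_ge hp hψ hα (((Pi.evalAddMonoidHom (fun _ : ι => F) i).comp π).comp
      H.subtype) ⟨⟨g, hg⟩, (Finset.mem_filter.1 hi).2⟩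
  have h3 := hm g hg0
  simp only [Finset.sum_const, Finset.card_univ, nsmul_eq_mul] at h1 h2
  have h4 : ((Finset.univ.filter (fun i => π g i ≠ 0)).card : ℝ) = hammingNorm (π g) := rfl
  rw [h4] at h2
  have h5 : (0 : ℝ) < Fintype.card H := Nat.cast_pos.2 Fintype.card_pos
  nlinarith [mul_nonneg hα0 h5.le]

theorem AddChar.map_sum_eq_prod' {A R κ : Type*} [AddCommMonoid A] [CommMonoid R]
    (ψ : AddChar A R) (s : Finset κ) (f : κ → A) : ψ (∑ i ∈ s, f i) = ∏ i ∈ s, ψ (f i) := by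
  classical
  induction s using Finset.induction_on with
  | empty => simp
  | insert a s ha ih => rw [Finset.sum_insert ha, Finset.prod_insert ha, map_add_eq_mul, ih]

omit [DecidableEq F] in
theorem sum_prodWeight_mul_addChar (w : ι → F) :
    ∑ x : ι → F, (prodWeight p x : ℂ) * ψ (x ⬝ᵥ w) = ∏ i, charFn ψ p (w i) := by
  have h := sum_prodWeight_mul_prod (R := ℂ) (κ := ι) p (fun i y => ψ (w i * y))
  simp only [Complex.coe_algebraMap] at h
  unfold charFn
  rw [← h]
  refine Finset.sum_congr rfl fun x _ => ?_
  congr 1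
  rw [dotProduct, AddChar.map_sum_eq_prod']
  exact Finset.prod_congr rfl fun i _ => by rw [mul_comm]

open scoped Classical in
/-- Orthogonality of characters on `G`. -/
theorem card_mul_prob_kills (hψ : ψ ≠ 1) (G : Submodule F (ι → F)) :
    (Nat.card G : ℂ) * (prob (prodWeight p) (fun x : ι → F => Kills x G) : ℂ) =
      ∑ w : G, ∏ i, charFn ψ p (w.1 i) := by
  have horth : ∀ x : ι → F, ∑ w : G, ψ (x ⬝ᵥ w.1) = if Kills x G then (Nat.card G : ℂ) else 0 := by
    intro x
    let L : G →+ F := ((dotProductBilin F F x).comp G.subtype).toAddMonoidHom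
    let χ : AddChar G ℂ := ψ.compAddMonoidHom L
    have hχ : ∑ w : G, ψ (x ⬝ᵥ w.1) = ∑ w, χ w := rfl
    rw [hχ, AddChar.sum_eq_ite, Nat.card_eq_fintype_card]
    have : χ = 0 ↔ Kills x G := by
      rw [AddChar.eq_zero_iff]
      constructor
      · intro h w hw
        by_contra hne
        apply hψ
        rw [AddChar.eq_one_iff]
        intro y
        have h1 := h ⟨(y * (x ⬝ᵥ w)⁻¹) • w, G.smul_mem _ hw⟩
        have h2 : χ ⟨(y * (x ⬝ᵥ w)⁻¹) • w, G.smul_mem _ hw⟩ =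
          ψ (x ⬝ᵥ ((y * (x ⬝ᵥ w)⁻¹) • w)) := rfl
        rwa [h2, dotProduct_smul, smul_eq_mul, mul_assoc, inv_mul_cancel₀ hne, mul_one] at h1
      · intro h w
        have h2 : χ w = ψ (x ⬝ᵥ w.1) := rfl
        rw [h2, h w.1 w.2, AddChar.map_zero_eq_one]
    simp [this]
  simp_rw [← sum_prodWeight_mul_addChar]
  rw [Finset.sum_comm]
  simp_rw [← Finset.mul_sum, horth]
  unfold prob
  push_cast
  rw [Finset.mul_sum]
  refine Finset.sum_congr rfl fun x _ => ?_
  by_cases h : Kills x G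
  · simp [h, mul_comm]
  · simp [h]

omit [DecidableEq ι] [DecidableEq F] in
theorem norm_charFn_le_one (hp : IsProbVec p) (x : F) : ‖charFn ψ p x‖ ≤ 1 :=
  (norm_charFn_le hp x).trans (Real.exp_le_one_iff.2 (by linarith [defect_nonneg (ψ := ψ) hp x]))

omit [DecidableEq ι] [DecidableEq F] in
theorem card_submodule_pos (G : Submodule F (ι → F)) : (0 : ℝ) < Nat.card G :=
  Nat.cast_pos.2 Nat.card_pos

omit [DecidableEq ι] [DecidableEq F] in
theorem charFn_zero (hp : IsProbVec p) : charFn ψ p 0 = 1 := by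
  have : ((∑ y, p y : ℝ) : ℂ) = 1 := by rw [hp.sum_eq_one]; simp
  simpa [charFn] using this

open scoped Classical in
theorem card_mul_fourierError (hp : IsProbVec p) (G : Submodule F (ι → F)) :
    Nat.card G * fourierError ψ p G =
      ∑ w ∈ (Finset.univ : Finset G).erase 0, ∏ i, ‖charFn ψ p (w.1 i)‖ := by
  have hc := card_submodule_pos G
  rw [fourierError, mul_inv_cancel_left₀ hc.ne', ← Finset.add_sum_erase _ _ (Finset.mem_univ 0)]
  simp [charFn_zero hp]

theorem abs_prob_kills_sub_le (hp : IsProbVec p) (hψ : ψ ≠ 1) (G : Submodule F (ι → F)) :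
    |prob (prodWeight p) (fun x : ι → F => Kills x G) - (Nat.card G : ℝ)⁻¹| ≤
      fourierError ψ p G := by
  classical
  have h := card_mul_prob_kills (p := p) hψ G
  have hc := card_submodule_pos G
  set P := prob (prodWeight p) (fun x : ι → F => Kills x G)
  rw [← Finset.add_sum_erase _ _ (Finset.mem_univ (0 : G))] at h
  simp only [ZeroMemClass.coe_zero, Pi.zero_apply, charFn_zero hp, Finset.prod_const_one] at h
  have h1 : (((Nat.card G : ℝ) * P - 1 : ℝ) : ℂ) =
      ∑ w ∈ (Finset.univ : Finset G).erase 0, ∏ i, charFn ψ p (w.1 i) := by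
    push_cast
    rw [h]; ring
  have h2 : |(Nat.card G : ℝ) * P - 1| ≤
      ∑ w ∈ (Finset.univ : Finset G).erase 0, ∏ i, ‖charFn ψ p (w.1 i)‖ := by
    rw [← Real.norm_eq_abs, ← Complex.norm_real, h1]
    refine (norm_sum_le _ _).trans (Finset.sum_le_sum fun w _ => ?_)
    rw [norm_prod]
  have h3 : P - (Nat.card G : ℝ)⁻¹ = (Nat.card G : ℝ)⁻¹ * (Nat.card G * P - 1) := by
    field_simp
  rw [h3, abs_mul, abs_of_pos (inv_pos.2 hc), inv_mul_le_iff₀ hc, card_mul_fourierError hp]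
  exact h2

theorem prob_kills_le (hp : IsProbVec p) (hψ : ψ ≠ 1) (G : Submodule F (ι → F)) :
    prob (prodWeight p) (fun x : ι → F => Kills x G) ≤
      (Nat.card G : ℝ)⁻¹ + fourierError ψ p G := by
  linarith [(abs_le.1 (abs_prob_kills_sub_le hp hψ G)).2]

theorem fourierError_le_one (hp : IsProbVec p) (G : Submodule F (ι → F)) :
    fourierError ψ p G ≤ 1 := by
  classical
  have hc := card_submodule_pos G
  refine le_of_mul_le_mul_left ?_ hc
  rw [card_mul_fourierError hp, mul_one, Nat.card_eq_fintype_card]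
  refine (Finset.sum_le_card_nsmul _ _ 1 fun w _ => Finset.prod_le_one
    (fun _ _ => norm_nonneg _) fun i _ => norm_charFn_le_one hp _).trans ?_
  rw [nsmul_eq_mul, mul_one, Nat.cast_le]
  exact Finset.card_le_univ _

omit [DecidableEq ι] [DecidableEq F] in
theorem prod_norm_charFn_le (hp : IsProbVec p) (w : ι → F) :
    ∏ i, ‖charFn ψ p (w i)‖ ≤ Real.exp (-(totalDefect ψ p w / 2)) := by
  rw [totalDefect, Finset.sum_div, ← Finset.sum_neg_distrib, Real.exp_sum]
  exact Finset.prod_le_prod (fun _ _ => norm_nonneg _) fun i _ => norm_charFn_le hp _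

omit [DecidableEq ι] [DecidableEq F] in
theorem exp_le_prod_lazy (hp : IsProbVec p) {β : ℝ} (h0 : 0 ≤ β) (h1 : β ≤ 1 / 2) (w : ι → F) :
    Real.exp (-(2 * β * totalDefect ψ p w)) ≤ ∏ i, (1 - β * defect ψ p (w i)) := by
  rw [totalDefect, Finset.mul_sum, ← Finset.sum_neg_distrib, Real.exp_sum]
  refine Finset.prod_le_prod (fun _ _ => (Real.exp_pos _).le) fun i _ => ?_
  have hd0 := defect_nonneg (ψ := ψ) hp (w i)
  have hd1 := defect_le_one (ψ := ψ) hp (w i)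
  set x := β * defect ψ p (w i) with hx
  have hx0 : 0 ≤ x := mul_nonneg h0 hd0
  have hx1 : x ≤ 1 / 2 := by nlinarith
  rw [show 2 * β * defect ψ p (w i) = 2 * x by rw [hx]; ring, Real.exp_neg]
  have := Real.add_one_le_exp (2 * x)
  rw [inv_le_iff_one_le_mul₀ (Real.exp_pos _)]
  nlinarith

open scoped Classical in
theorem card_mul_prob_kills_lazy (hp : IsProbVec p) (hψ : ψ ≠ 1) (β : ℝ)
    (G : Submodule F (ι → F)) :
    (Nat.card G : ℝ) * prob (prodWeight (lazyWeight β p)) (fun x : ι → F => Kills x G) =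
      ∑ w : G, ∏ i, (1 - β * defect ψ p (w.1 i)) := by
  have h := card_mul_prob_kills (p := lazyWeight β p) hψ G
  simp only [charFn_lazyWeight hp] at h
  exact_mod_cast h

/-- If all non-zero vectors of `G` have at least `m` non-zero coordinates, the Fourier error of a
random row is at most a small multiple of the probability that a lazy row is orthogonal to `G`. -/
theorem fourierError_le_lazy (hp : IsProbVec p) (hψ : ψ ≠ 1) {α m : ℝ} (hα0 : 0 < α)
    (hα : DenseWeight α p) (hm0 : 0 < m) {j : ℕ} (hj : 1 ≤ j) (G : Submodule F (ι → F))
    (hm : ∀ w ∈ G, w ≠ 0 → m ≤ hammingNorm w) :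
    fourierError ψ p G ≤ ((2 ^ j)⁻¹ + Real.exp (-(α * m / 16 ^ j / 4))) *
      prob (prodWeight (lazyWeight (4 * 16 ^ j)⁻¹ p)) (fun x : ι → F => Kills x G) := by
  classical
  have hc := card_submodule_pos G
  have h16 : (16 : ℝ) ≤ 16 ^ j := by
    calc (16 : ℝ) = 16 ^ 1 := by norm_num
      _ ≤ 16 ^ j := pow_le_pow_right₀ (by norm_num) hj
  set β : ℝ := (4 * 16 ^ j)⁻¹ with hβ
  have hβ0 : 0 < β := by positivity
  have hβ1 : β ≤ 1 / 2 := by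
    rw [hβ, inv_le_comm₀ (by positivity) (by norm_num)]; linarith
  have hβ2 : ∀ x, x / (2 * 16 ^ j) = 2 * β * x := fun x => by rw [hβ]; field_simp; norm_num
  have hS := isSquaredSeminorm_totalDefect (ψ := ψ) hp G.subtype.toAddMonoidHom
  have hL := largeOnSubgroups_totalDefect hp hψ hα0.le hα G.subtype.toAddMonoidHom
    (m := m) (fun g hg => hm g.1 g.2 fun h => hg (Subtype.ext h))
  have h1 := sum_exp_ne_zero_le hS hL (by positivity) j
  simp only [LinearMap.toAddMonoidHom_coe, Submodule.coe_subtype] at h1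
  have h2 : ∑ w : G, Real.exp (-(totalDefect ψ p w.1 / (2 * 16 ^ j))) ≤
      Nat.card G * prob (prodWeight (lazyWeight β p)) (fun x : ι → F => Kills x G) := by
    rw [card_mul_prob_kills_lazy hp hψ]
    refine Finset.sum_le_sum fun w _ => ?_
    rw [hβ2]
    exact exp_le_prod_lazy hp hβ0.le hβ1 _
  have h3 : ∑ w : G, Real.exp (-(totalDefect ψ p w.1 / 4)) ≤
      ∑ w : G, Real.exp (-(totalDefect ψ p w.1 / (2 * 16 ^ j))) := by
    refine Finset.sum_le_sum fun w _ => Real.exp_le_exp.2 (neg_le_neg ?_)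
    exact div_le_div_of_nonneg_left (hS.nonneg w) (by norm_num) (by linarith)
  refine le_of_mul_le_mul_left ?_ hc
  rw [card_mul_fourierError hp]
  calc ∑ w ∈ (Finset.univ : Finset G).erase 0, ∏ i, ‖charFn ψ p (w.1 i)‖
      ≤ ∑ w ∈ (Finset.univ : Finset G).erase 0, Real.exp (-(totalDefect ψ p w.1 / 2)) :=
        Finset.sum_le_sum fun w _ => prod_norm_charFn_le hp _
    _ ≤ _ := h1
    _ ≤ ((2 ^ j)⁻¹ + Real.exp (-(α * m / 16 ^ j / 4))) *
        ∑ w : G, Real.exp (-(totalDefect ψ p w.1 / (2 * 16 ^ j))) := by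
      rw [add_mul]
      gcongr
    _ ≤ _ := by
      rw [mul_left_comm]
      exact mul_le_mul_of_nonneg_left h2 (by positivity)

/-- The inner product of a random row with `v` takes the value `t` with probability `1 / |F|`, up to
the Fourier sum along the line through `v`. -/
theorem abs_prob_dotProduct_eq_sub_le (hp : IsProbVec p) (hψ : ψ ≠ 1) (v : ι → F) (t : F) :
    |prob (prodWeight p) (fun x : ι → F => x ⬝ᵥ v = t) - (Fintype.card F : ℝ)⁻¹| ≤
      (Fintype.card F : ℝ)⁻¹ * ∑ a ∈ Finset.univ.filter (fun a : F => a ≠ 0),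
        ∏ i, ‖charFn ψ p (a * v i)‖ := by
  classical
  set q : ℝ := (Fintype.card F : ℝ) with hq
  have hq0 : 0 < q := Nat.cast_pos.2 Fintype.card_pos
  set P := prob (prodWeight p) (fun x : ι → F => x ⬝ᵥ v = t)
  have horth : ∀ b : F, ∑ a, ψ (a * b) = if b = 0 then (q : ℂ) else 0 := by
    intro b
    rw [AddChar.sum_mulShift b (AddChar.IsPrimitive.of_ne_one hψ)]
    simp [hq]
  have h1 : ((q * P : ℝ) : ℂ) = ∑ a : F, ψ (-(a * t)) * ∏ i, charFn ψ p (a * v i) := by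
    have : ∀ a : F, ψ (-(a * t)) * ∏ i, charFn ψ p (a * v i) =
        ∑ x : ι → F, (prodWeight p x : ℂ) * ψ (a * (x ⬝ᵥ v - t)) := by
      intro a
      have h := sum_prodWeight_mul_addChar (ψ := ψ) (p := p) (a • v)
      simp only [Pi.smul_apply, smul_eq_mul] at h
      rw [← h, Finset.mul_sum]
      refine Finset.sum_congr rfl fun x _ => ?_
      rw [dotProduct_smul, smul_eq_mul, mul_sub, sub_eq_add_neg, AddChar.map_add_eq_mul]
      ring
    simp_rw [this]
    rw [Finset.sum_comm]
    simp_rw [← Finset.mul_sum, horth, sub_eq_zero]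
    simp only [P, prob]
    push_cast
    rw [Finset.mul_sum]
    refine Finset.sum_congr rfl fun x _ => ?_
    by_cases h : x ⬝ᵥ v = t
    · simp [h, mul_comm]
    · simp [h]
  have h2 : ((q * P - 1 : ℝ) : ℂ) = ∑ a ∈ Finset.univ.filter (fun a : F => a ≠ 0),
      ψ (-(a * t)) * ∏ i, charFn ψ p (a * v i) := by
    rw [Finset.filter_ne', Complex.ofReal_sub, h1, ← Finset.add_sum_erase _ _ (Finset.mem_univ 0)]
    simp [charFn_zero hp]
  have h3 : |q * P - 1| ≤ ∑ a ∈ Finset.univ.filter (fun a : F => a ≠ 0),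
      ∏ i, ‖charFn ψ p (a * v i)‖ := by
    rw [← Real.norm_eq_abs, ← Complex.norm_real, h2]
    refine (norm_sum_le _ _).trans (Finset.sum_le_sum fun w _ => ?_)
    rw [norm_mul, norm_prod, AddChar.norm_apply, one_mul]
  have h4 : P - q⁻¹ = q⁻¹ * (q * P - 1) := by field_simp
  rw [h4, abs_mul, abs_of_pos (inv_pos.2 hq0)]
  exact mul_le_mul_of_nonneg_left h3 (inv_pos.2 hq0).le

/-- The probability that a random row is orthogonal to a non-zero vector is bounded away from `1` in
terms of the number of non-zero coordinates: the sublevel sets of the total defect on the line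
through the vector contain at most half of the line. -/
theorem prob_dotProduct_eq_zero_le (hp : IsProbVec p) (hψ : ψ ≠ 1) {α : ℝ} (hα0 : 0 < α)
    (hα : DenseWeight α p) {v : ι → F} (hv : v ≠ 0) :
    prob (prodWeight p) (fun x : ι → F => x ⬝ᵥ v = 0) ≤
      1 / 2 + 1 / 2 * Real.exp (-(α * hammingNorm v / 10)) := by
  set q : ℝ := (Fintype.card F : ℝ) with hq
  have hq0 : 0 < q := Nat.cast_pos.2 Fintype.card_pos
  have h1 := (abs_le.1 (abs_prob_dotProduct_eq_sub_le hp hψ v 0)).2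
  let π : F →+ (ι → F) := ((LinearMap.toSpanSingleton F (ι → F) v)).toAddMonoidHom
  have hπ : ∀ a, π a = a • v := fun a => rfl
  have hnorm : ∀ a, a ≠ 0 → hammingNorm (π a) = hammingNorm v := fun a ha => by
    rw [hπ, hammingNorm_smul]
    intro i
    exact IsSMulRegular.of_ne_zero ha
  have hL := largeOnSubgroups_totalDefect hp hψ hα0.le hα π (m := hammingNorm v)
    (fun a ha => by rw [hnorm a ha])
  have hpos : (0 : ℝ) < hammingNorm v := Nat.cast_pos.2 (hammingNorm_pos_iff.2 hv)
  have h2 := sum_exp_le_half (isSquaredSeminorm_totalDefect (ψ := ψ) hp π) hL (by positivity)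
  have h3 : 1 + ∑ a ∈ Finset.univ.filter (fun a : F => a ≠ 0), ∏ i, ‖charFn ψ p (a * v i)‖ ≤
      ∑ a, Real.exp (-(totalDefect ψ p (π a) / 2)) := by
    rw [Finset.filter_ne', ← Finset.add_sum_erase _ _ (Finset.mem_univ 0)]
    refine add_le_add ?_ (Finset.sum_le_sum fun a _ => prod_norm_charFn_le hp (π a))
    simp [totalDefect, defect_zero]
  have h4 := (sub_le_iff_le_add.1 h1).trans_eq (show _ = q⁻¹ * (1 + ∑ a ∈ Finset.univ.filter
    (fun a : F => a ≠ 0), ∏ i, ‖charFn ψ p (a * v i)‖) by ring)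
  refine h4.trans ?_
  rw [← div_eq_inv_mul, div_le_iff₀ hq0]
  linarith

end Rows

/-! ### Common orthogonal complements of families of rows -/

/-- The vectors orthogonal to all rows of the family `X`. -/
def rowKer {ι κ F : Type*} [Fintype ι] [Field F] (X : κ → ι → F) : Submodule F (ι → F) where
  carrier := {w | ∀ j, X j ⬝ᵥ w = 0}
  zero_mem' := by simp
  add_mem' := by
    intro a b ha hb j
    rw [dotProduct_add, ha j, hb j, add_zero]
  smul_mem' := by
    intro c a ha j
    rw [dotProduct_smul, ha j, smul_zero]

section LinearAlgebra

variable {ι κ F : Type*} [Fintype ι] [Field F]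

theorem mem_rowKer {X : κ → ι → F} {w : ι → F} : w ∈ rowKer X ↔ ∀ j, X j ⬝ᵥ w = 0 := Iff.rfl

theorem le_rowKer_iff {X : κ → ι → F} {G : Submodule F (ι → F)} :
    G ≤ rowKer X ↔ ∀ j, Kills (X j) G :=
  ⟨fun h j _ hw => h hw j, fun h w hw j => h j w hw⟩

/-- A row which is not orthogonal to `E` cuts the dimension of `E` by one. -/
theorem finrank_inf_rowKer_add_one (E : Submodule F (ι → F)) {x : ι → F} (hx : ¬ Kills x E) :
    Module.finrank F ↥(E ⊓ rowKer fun _ : Unit => x) + 1 = Module.finrank F E := by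
  let f : Module.Dual F E := (dotProductBilin F F x).comp E.subtype
  have hf : f ≠ 0 := by
    intro h
    refine hx fun w hw => ?_
    have := LinearMap.congr_fun h ⟨w, hw⟩
    exact this
  have hmap : E ⊓ rowKer (fun _ : Unit => x) = (LinearMap.ker f).map E.subtype := by
    ext w
    constructor
    · exact fun h => ⟨⟨w, h.1⟩, h.2 (), rfl⟩
    · rintro ⟨v, hv, rfl⟩
      exact ⟨v.2, fun _ => hv⟩
  rw [← Module.Dual.finrank_ker_add_one_of_ne_zero hf, hmap, Submodule.finrank_map_subtype_eq]

theorem rowKer_snoc {k : ℕ} (Y : Fin k → ι → F) (z : ι → F) :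
    rowKer (Fin.snoc Y z : Fin (k + 1) → ι → F) = rowKer Y ⊓ rowKer fun _ : Unit => z := by
  ext w
  simp [mem_rowKer, Fin.forall_fin_succ']

theorem card_le_finrank_rowKer_add {k : ℕ} (Y : Fin k → ι → F) :
    Fintype.card ι ≤ Module.finrank F (rowKer Y) + k := by
  induction k with
  | zero =>
    have : rowKer Y = ⊤ := by ext w; simp [mem_rowKer]
    rw [this]; simp
  | succ k ih =>
    rw [← Fin.snoc_init_self Y, rowKer_snoc]
    have h := ih (Fin.init Y)
    by_cases hk : Kills (Y (Fin.last k)) (rowKer (Fin.init Y))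
    · rw [inf_eq_left.2 (le_rowKer_iff.2 fun _ => hk)]
      omega
    · have := finrank_inf_rowKer_add_one _ hk
      omega

/-- The family `snoc Y z` has full rank exactly if `Y` has full rank and `z` is not orthogonal to
the complement of `Y`. -/
theorem finrank_rowKer_snoc_iff {k : ℕ} (Y : Fin k → ι → F) (z : ι → F) :
    Module.finrank F (rowKer (Fin.snoc Y z : Fin (k + 1) → ι → F)) + (k + 1) = Fintype.card ι ↔
      Module.finrank F (rowKer Y) + k = Fintype.card ι ∧ ¬ Kills z (rowKer Y) := by
  rw [rowKer_snoc]
  by_cases hk : Kills z (rowKer Y)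
  · rw [inf_eq_left.2 (le_rowKer_iff.2 fun _ => hk)]
    have := card_le_finrank_rowKer_add Y
    simp only [hk, not_true, and_false, iff_false]
    omega
  · have := finrank_inf_rowKer_add_one _ hk
    simp only [hk, not_false_iff, and_true]
    omega

/-- A subfamily of rows, of size at most the codimension of `E ⊓ rowKer X` in `E`, that cuts out
the same subspace of `E` as the whole family. -/
theorem exists_subfamily_rowKer [Fintype κ] (E : Submodule F (ι → F)) (X : κ → ι → F) :
    ∃ J : Finset κ, J.card + Module.finrank F ↥(E ⊓ rowKer X) ≤ Module.finrank F E ∧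
      E ⊓ rowKer (fun j : {j // j ∈ J} => X j) = E ⊓ rowKer X := by
  classical
  suffices h : ∀ s : Finset κ, ∃ J : Finset κ,
      J.card + Module.finrank F ↥(E ⊓ rowKer (fun j : {j // j ∈ s} => X j)) ≤ Module.finrank F E ∧
        E ⊓ rowKer (fun j : {j // j ∈ J} => X j) = E ⊓ rowKer (fun j : {j // j ∈ s} => X j) by
    obtain ⟨J, h1, h2⟩ := h Finset.univ
    have : rowKer (fun j : {j // j ∈ (Finset.univ : Finset κ)} => X j) = rowKer X := by
      ext w; simp [mem_rowKer]
    rw [this] at h1 h2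
    exact ⟨J, h1, h2⟩
  intro s
  induction s using Finset.induction_on with
  | empty =>
    refine ⟨∅, ?_, rfl⟩
    have : rowKer (fun j : {j // j ∈ (∅ : Finset κ)} => X j) = ⊤ := by ext w; simp [mem_rowKer]
    rw [this, inf_top_eq]; simp
  | insert a s ha ih =>
    obtain ⟨J, h1, h2⟩ := ih
    have hins : ∀ t : Finset κ, E ⊓ rowKer (fun j : {j // j ∈ insert a t} => X j) =
        (E ⊓ rowKer (fun j : {j // j ∈ t} => X j)) ⊓ rowKer fun _ : Unit => X a := by
      intro t; ext w; simp [mem_rowKer]; tauto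
    by_cases hk : Kills (X a) (E ⊓ rowKer (fun j : {j // j ∈ s} => X j))
    · refine ⟨J, ?_, ?_⟩
      · rw [hins, inf_eq_left.2 (le_rowKer_iff.2 fun _ => hk)]; exact h1
      · rw [hins, inf_eq_left.2 (le_rowKer_iff.2 fun _ => hk)]; exact h2
    · have := finrank_inf_rowKer_add_one _ hk
      refine ⟨insert a J, ?_, ?_⟩
      · rw [hins]
        have := Finset.card_insert_le a J
        omega
      · rw [hins, hins, h2]

end LinearAlgebra

section Rows

variable {ι κ F : Type*} [Fintype ι] [DecidableEq ι] [Field F] [Fintype F] {p : F → ℝ}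

/-- If no value has probability above `1 - a`, a random row is orthogonal to `E` with probability
at most `(1 - a) ^ dim E`: `dim E` of its coordinates are determined by the others. -/
theorem prob_kills_le_pow (hp : IsProbVec p) {a : ℝ} (ha : ∀ y, p y ≤ 1 - a)
    (E : Submodule F (ι → F)) :
    prob (prodWeight p) (fun x : ι → F => Kills x E) ≤ (1 - a) ^ Module.finrank F E := by
  classical
  obtain ⟨J, hJ1, hJ2⟩ := exists_subfamily_rowKer E (fun i : ι => (Pi.single i 1 : ι → F))
  have hker : rowKer (fun i : ι => (Pi.single i 1 : ι → F)) = ⊥ := by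
    ext w; simp [mem_rowKer, funext_iff]
  rw [hker, inf_bot_eq] at hJ1 hJ2
  simp only [finrank_bot, add_zero] at hJ1
  let R : E →ₗ[F] ({i // i ∈ J} → F) :=
    (LinearMap.funLeft F F (Subtype.val : {i // i ∈ J} → ι)).comp E.subtype
  have hRa : ∀ w i, R w i = w.1 i.1 := fun w i => rfl
  have hinj : Function.Injective R := by
    rw [← LinearMap.ker_eq_bot, LinearMap.ker_eq_bot']
    intro w hw
    have : w.1 ∈ E ⊓ rowKer (fun j : {j // j ∈ J} => (Pi.single j.1 1 : ι → F)) := by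
      refine ⟨w.2, fun j => ?_⟩
      simpa [hRa] using congrFun hw j
    rw [hJ2] at this
    exact Subtype.ext this
  have hcard : Module.finrank F E = J.card := by
    have := LinearMap.finrank_le_finrank_of_injective hinj
    simp at this
    omega
  have hsurj : Function.Surjective R :=
    (LinearMap.injective_iff_surjective_of_finrank_eq_finrank (by simp [hcard])).1 hinj
  have hp1 : (1 - a) ≥ 0 := (hp.nonneg 0).trans (ha 0)
  -- `E` projects isomorphically onto the coordinates in `J`, so the other coordinates of a vector
  -- orthogonal to `E` determine those in `J`
  have huniq : ∀ x x' : ι → F, Kills x E → Kills x' E → (∀ i, i ∉ J → x i = x' i) →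
      ∀ i ∈ J, x i = x' i := by
    intro x x' hx hx' hxx i hi
    obtain ⟨w, hw⟩ := hsurj (Pi.single ⟨i, hi⟩ 1)
    have h1 : (x - x') ⬝ᵥ w.1 = 0 := by
      rw [sub_dotProduct, hx _ w.2, hx' _ w.2, sub_zero]
    have h2 : (x - x') ⬝ᵥ w.1 = x i - x' i := by
      rw [dotProduct, Finset.sum_eq_single i]
      · have : w.1 i = 1 := by rw [← hRa w ⟨i, hi⟩, hw]; simp
        simp [this]
      · intro l _ hli
        by_cases hl : l ∈ J
        · have : w.1 l = 0 := by
            rw [← hRa w ⟨l, hl⟩, hw, Pi.single_eq_of_ne (fun h => hli (congrArg Subtype.val h))]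
          simp [this]
        · simp [hxx l hl]
      · simp
    rw [h1] at h2
    exact (sub_eq_zero.1 h2.symm)
  let glue : ({i // i ∉ J} → F) → ({i // ¬ i ∉ J} → F) → ι → F := fun y z =>
    (Equiv.piEquivPiSubtypeProd (fun i => i ∉ J) (fun _ => F)).symm (y, z)
  have hglue : ∀ x : ι → F, glue (fun j => x j) (fun j => x j) = x := fun x =>
    (Equiv.piEquivPiSubtypeProd (fun i => i ∉ J) (fun _ => F)).symm_apply_apply x
  have hsplit := sum_prodWeight_split p (fun i => i ∉ J)
    (fun y z => if Kills (glue y z) E then (1 : ℝ) else 0)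
  simp only [hglue] at hsplit
  rw [prob_eq_sum_mul, hsplit]
  have hinner : ∀ y : {i // i ∉ J} → F, ∑ z : {i // ¬ i ∉ J} → F,
      prodWeight p z * (if Kills (glue y z) E then (1 : ℝ) else 0) ≤ (1 - a) ^ J.card := by
    intro y
    by_cases hex : ∃ z, Kills (glue y z) E
    · obtain ⟨z, hz⟩ := hex
      rw [Finset.sum_eq_single z]
      · rw [if_pos hz, mul_one, prodWeight]
        refine (Finset.prod_le_prod (fun i _ => hp.nonneg _) fun i _ => ha _).trans_eq ?_
        rw [Finset.prod_const, Finset.card_univ]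
        congr 1
        rw [Fintype.card_subtype]
        simp
      · intro z' _ hne
        rw [if_neg, mul_zero]
        intro hz'
        apply hne
        ext i
        have hi : i.1 ∈ J := not_not.1 i.2
        have := huniq _ _ hz' hz (fun l hl => by
          simp [glue, Equiv.piEquivPiSubtypeProd, hl]) i.1 hi
        simpa [glue, Equiv.piEquivPiSubtypeProd, hi] using this
      · simp
    · push Not at hex
      simp only [hex, if_false, mul_zero, Finset.sum_const_zero]
      positivity
  have hW := hp.prodWeight (κ := {i // i ∉ J})
  calc _ ≤ ∑ y : {i // i ∉ J} → F, prodWeight p y * (1 - a) ^ J.card :=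
        Finset.sum_le_sum fun y _ => mul_le_mul_of_nonneg_left (hinner y) (hW.nonneg _)
    _ = _ := by rw [← Finset.sum_mul, hW.sum_eq_one, one_mul, hcard]

open scoped Classical in
/-- Independent rows are, with the expected probability up to a factor `2 ^ r`, orthogonal to `G`
and linearly independent. -/
theorem pow_le_prob_kills_and_finrank (hp : IsProbVec p) (G : Submodule F (ι → F)) {P : ℝ}
    (hP0 : 0 ≤ P) (hP : P ≤ prob (prodWeight p) (fun x : ι → F => Kills x G)) (r : ℕ)
    (hE : ∀ E : Submodule F (ι → F), Fintype.card ι < Module.finrank F E + r →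
      prob (prodWeight p) (fun x : ι → F => Kills x E) ≤ P / 2) :
    (P / 2) ^ r ≤ prob (prodWeight (prodWeight p)) (fun Y : Fin r → ι → F =>
      G ≤ rowKer Y ∧ Module.finrank F (rowKer Y) + r = Fintype.card ι) := by
  induction r with
  | zero =>
    have : ∀ Y : Fin 0 → ι → F, rowKer Y = ⊤ := fun Y => by ext w; simp [mem_rowKer]
    rw [pow_zero, ← prob_true ((hp.prodWeight (κ := ι)).prodWeight (κ := Fin 0))]
    refine prob_mono hp.prodWeight.prodWeight fun Y _ => ?_
    rw [this]
    simp
  | succ r ih =>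
    have ih' := ih fun E hE' => hE E (by omega)
    have hW := (hp.prodWeight (κ := ι))
    rw [prob_eq_sum_mul, sum_prodWeight_snoc, pow_succ]
    refine (mul_le_mul_of_nonneg_right ih' (by positivity)).trans ?_
    rw [prob_eq_sum_mul, Finset.sum_mul]
    refine Finset.sum_le_sum fun Y _ => ?_
    rw [mul_assoc]
    refine mul_le_mul_of_nonneg_left ?_ (hW.prodWeight.nonneg _)
    split_ifs with hY
    · have h1 := hE (rowKer Y) (by omega)
      rw [one_mul]
      have h2 : prob (prodWeight p) (fun x : ι → F => Kills x G) ≤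
          prob (prodWeight p) (fun x : ι → F => Kills x (rowKer Y)) +
          ∑ z : ι → F, prodWeight p z * (if G ≤ rowKer (Fin.snoc Y z : Fin (r + 1) → ι → F) ∧
            Module.finrank F (rowKer (Fin.snoc Y z : Fin (r + 1) → ι → F)) + (r + 1) =
              Fintype.card ι then 1 else 0) := by
        rw [prob_eq_sum_mul, prob_eq_sum_mul, ← Finset.sum_add_distrib]
        refine Finset.sum_le_sum fun z _ => ?_
        rw [← mul_add]
        refine mul_le_mul_of_nonneg_left ?_ (hW.nonneg _)
        simp only [finrank_rowKer_snoc_iff]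
        rw [rowKer_snoc, le_inf_iff]
        have h3 : G ≤ rowKer (fun _ : Unit => z) ↔ Kills z G := by simp [le_rowKer_iff]
        rw [h3]
        by_cases hz : Kills z G <;> by_cases hz' : Kills z (rowKer Y) <;> simp [hz, hz', hY]
      linarith
    · rw [zero_mul]
      exact Finset.sum_nonneg fun z _ => mul_nonneg (hW.nonneg _) (by split_ifs <;> simp)

open scoped Classical in
/-- Replacement of rows: if `G` runs over subspaces to which a row of law `p'` is much more likely
orthogonal than a row of law `p`, then it is unlikely that independent rows of law `p` have full
rank and such a `G` as their complement. Some `r` of the rows are exchanged for `r` independent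
rows of law `p'`; the other rows and the new ones determine `G`, so no union over `G` is
needed. -/
theorem prob_rowKer_bad_le [Fintype κ] [DecidableEq κ] (hp : IsProbVec p) {p' : F → ℝ}
    (hp' : IsProbVec p')
    (Bad : Submodule F (ι → F) → Prop) (r : ℕ) {c : ℝ} (hc : 0 ≤ c)
    (hpos : ∀ G, Bad G → 0 < prob (prodWeight p') (fun x : ι → F => Kills x G))
    (hlt : ∀ G, Bad G → prob (prodWeight p) (fun x : ι → F => Kills x G) ≤
      c * prob (prodWeight p') (fun x : ι → F => Kills x G))
    (hE : ∀ G, Bad G → ∀ E : Submodule F (ι → F), Fintype.card ι < Module.finrank F E + r →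
      prob (prodWeight p') (fun x : ι → F => Kills x E) ≤
        prob (prodWeight p') (fun x : ι → F => Kills x G) / 2) :
    prob (prodWeight (prodWeight p)) (fun X : κ → ι → F =>
      Module.finrank F (rowKer X) + Fintype.card κ = Fintype.card ι ∧ Bad (rowKer X)) ≤
      2 ^ Fintype.card κ * (2 * c) ^ r := by
  set Q : Submodule F (ι → F) → ℝ := fun G => prob (prodWeight p') (fun x : ι → F => Kills x G)
    with hQ
  set P : Submodule F (ι → F) → ℝ := fun G => prob (prodWeight p) (fun x : ι → F => Kills x G)
    with hPdef
  set d : Submodule F (ι → F) → ℝ := fun G => ((Q G / 2) ^ r)⁻¹ with hd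
  have hW := (hp.prodWeight (κ := ι)).prodWeight (κ := κ)
  have hW' := (hp'.prodWeight (κ := ι)).prodWeight (κ := Fin r)
  have hQ0 : ∀ G, 0 ≤ Q G := fun G => prob_nonneg hp'.prodWeight _
  have hP0 : ∀ G, 0 ≤ P G := fun G => prob_nonneg hp.prodWeight _
  have hP1 : ∀ G, P G ≤ 1 := fun G => prob_le_one hp.prodWeight _
  have hd0 : ∀ G, 0 ≤ d G := fun G => by have := hQ0 G; positivity
  -- the complement recovered from the new rows `Y` and the old rows with index in `I`
  let rec' : (Fin r → ι → F) → (I : Finset κ) → ({j // j ∈ I} → ι → F) → Submodule F (ι → F) :=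
    fun Y I X => rowKer Y ⊓ rowKer X
  let term : (Fin r → ι → F) → (I : Finset κ) → ({j // j ∈ I} → ι → F) →
      ({j // j ∉ I} → ι → F) → ℝ := fun Y I X X' =>
    if I.card + r ≤ Fintype.card κ ∧ Bad (rec' Y I X) ∧ (∀ j, Kills (X' j) (rec' Y I X))
      then d (rec' Y I X) else 0
  have hterm0 : ∀ Y I X X', 0 ≤ term Y I X X' := fun Y I X X' => by
    simp only [term]; split_ifs <;> simp [hd0]
  -- for given `X`, suitable new rows appear with probability at least `1 / d (rowKer X)`, and for
  -- each of them some set `I` of at most `|κ| - r` old rows recovers `rowKer X`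
  have hindicator : ∀ X : κ → ι → F,
      (if Module.finrank F (rowKer X) + Fintype.card κ = Fintype.card ι ∧ Bad (rowKer X)
        then (1 : ℝ) else 0) ≤ ∑ Y : Fin r → ι → F, prodWeight (prodWeight p') Y *
          ∑ I : Finset κ, term Y I (fun j => X j) (fun j => X j) := by
    intro X
    split_ifs with hX
    · have h1 := pow_le_prob_kills_and_finrank hp' (rowKer X) (hQ0 _) le_rfl r
        (hE _ hX.2)
      have hQpos := hpos _ hX.2
      have h2 : (1 : ℝ) ≤ d (rowKer X) * prob (prodWeight (prodWeight p'))
          (fun Y : Fin r → ι → F => rowKer X ≤ rowKer Y ∧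
            Module.finrank F (rowKer Y) + r = Fintype.card ι) := by
        have h3 : (0 : ℝ) < (Q (rowKer X) / 2) ^ r := by positivity
        calc (1 : ℝ) = d (rowKer X) * (Q (rowKer X) / 2) ^ r := by
              rw [hd]; exact (inv_mul_cancel₀ h3.ne').symm
          _ ≤ _ := mul_le_mul_of_nonneg_left h1 (hd0 _)
      refine h2.trans ?_
      rw [prob_eq_sum_mul, Finset.mul_sum]
      refine Finset.sum_le_sum fun Y _ => ?_
      rw [mul_left_comm]
      refine mul_le_mul_of_nonneg_left ?_ (hW'.nonneg _)
      split_ifs with hY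
      · rw [mul_one]
        obtain ⟨I, hI1, hI2⟩ := exists_subfamily_rowKer (rowKer Y) X
        rw [inf_eq_right.2 hY.1] at hI1 hI2
        have hrec : rec' Y I (fun j => X j) = rowKer X := hI2
        have hval : term Y I (fun j => X j) (fun j => X j) = d (rowKer X) := by
          simp only [term, hrec]
          rw [if_pos]
          exact ⟨by omega, hX.2, fun j => le_rowKer_iff.1 le_rfl j.1⟩
        rw [← hval]
        exact Finset.single_le_sum (f := fun I : Finset κ =>
          term Y I (fun j => X j) (fun j => X j)) (fun I _ => hterm0 _ _ _ _) (Finset.mem_univ I)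
      · rw [mul_zero]
        exact Finset.sum_nonneg fun I _ => hterm0 _ _ _ _
    · exact Finset.sum_nonneg fun Y _ => mul_nonneg (hW'.nonneg _)
        (Finset.sum_nonneg fun I _ => hterm0 _ _ _ _)
  -- once `Y` and the rows in `I` are fixed, so is the complement, and the at least `r` remaining
  -- rows are orthogonal to it independently
  have hexchange : ∀ (Y : Fin r → ι → F) (I : Finset κ),
      ∑ X : κ → ι → F, prodWeight (prodWeight p) X * term Y I (fun j => X j) (fun j => X j) ≤
        (2 * c) ^ r := by
    intro Y I
    have hsp : ∑ X : κ → ι → F, prodWeight (prodWeight p) X *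
        term Y I (fun j => X j) (fun j => X j) = ∑ X : {j // j ∈ I} → ι → F,
          prodWeight (prodWeight p) X * ∑ X' : {j // j ∉ I} → ι → F,
            prodWeight (prodWeight p) X' * term Y I X X' :=
      sum_prodWeight_split (V := ι → F) (prodWeight p) (fun j => j ∈ I) (term Y I)
    rw [hsp]
    have hWI := (hp.prodWeight (κ := ι)).prodWeight (κ := {j // j ∈ I})
    have hin : ∀ X : {j // j ∈ I} → ι → F,
        ∑ X' : {j // j ∉ I} → ι → F, prodWeight (prodWeight p) X' * term Y I X X' ≤
          (2 * c) ^ r := by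
      intro X
      by_cases hB : I.card + r ≤ Fintype.card κ ∧ Bad (rec' Y I X)
      · set G := rec' Y I X with hG
        have h1 : ∀ X' : {j // j ∉ I} → ι → F, prodWeight (prodWeight p) X' * term Y I X X' =
            prodWeight (prodWeight p) X' * (if ∀ j, Kills (X' j) G then 1 else 0) * d G := by
          intro X'
          simp only [term, ← hG, hB.1, hB.2, true_and]
          split_ifs <;> simp
        simp_rw [h1]
        rw [← Finset.sum_mul, ← prob_eq_sum_mul, prob_forall (κ := {j // j ∉ I}) (prodWeight p)
          (fun x : ι → F => Kills x G)]
        have hcardI : Fintype.card {j // j ∉ I} = Fintype.card κ - I.card := by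
          rw [Fintype.card_subtype_compl, Fintype.card_coe]
        rw [hcardI]
        have h2 : P G ^ (Fintype.card κ - I.card) ≤ P G ^ r :=
          pow_le_pow_of_le_one (hP0 G) (hP1 G) (by omega)
        have h3 : P G ^ r ≤ (c * Q G) ^ r := pow_le_pow_left₀ (hP0 G) (hlt G hB.2) r
        have hQpos : 0 < Q G := hpos G hB.2
        calc P G ^ (Fintype.card κ - I.card) * d G ≤ (c * Q G) ^ r * d G :=
              mul_le_mul_of_nonneg_right (h2.trans h3) (hd0 _)
          _ = (2 * c) ^ r := by
            simp only [hd]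
            rw [← inv_pow, ← mul_pow]
            congr 1
            field_simp
      · have h1 : ∀ X' : {j // j ∉ I} → ι → F, term Y I X X' = 0 := by
          intro X'
          simp only [term]
          rw [if_neg]
          exact fun h => hB ⟨h.1, h.2.1⟩
        simp only [h1, mul_zero, Finset.sum_const_zero]
        positivity
    calc _ ≤ ∑ X : {j // j ∈ I} → ι → F, prodWeight (prodWeight p) X * (2 * c) ^ r :=
          Finset.sum_le_sum fun X _ => mul_le_mul_of_nonneg_left (hin X) (hWI.nonneg _)
      _ = _ := by rw [← Finset.sum_mul, hWI.sum_eq_one, one_mul]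
  rw [prob_eq_sum_mul]
  calc _ ≤ ∑ X : κ → ι → F, prodWeight (prodWeight p) X *
        ∑ Y : Fin r → ι → F, prodWeight (prodWeight p') Y *
          ∑ I : Finset κ, term Y I (fun j => X j) (fun j => X j) :=
        Finset.sum_le_sum fun X _ => mul_le_mul_of_nonneg_left (hindicator X) (hW.nonneg _)
    _ = ∑ Y : Fin r → ι → F, prodWeight (prodWeight p') Y * ∑ I : Finset κ,
        ∑ X : κ → ι → F, prodWeight (prodWeight p) X *
          term Y I (fun j => X j) (fun j => X j) := by
      simp only [Finset.mul_sum]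
      rw [Finset.sum_comm]
      refine Finset.sum_congr rfl fun Y _ => ?_
      rw [Finset.sum_comm]
      refine Finset.sum_congr rfl fun I _ => Finset.sum_congr rfl fun X _ => ?_
      ring
    _ ≤ ∑ Y : Fin r → ι → F, prodWeight (prodWeight p') Y * ∑ _I : Finset κ, (2 * c) ^ r :=
      Finset.sum_le_sum fun Y _ => mul_le_mul_of_nonneg_left
        (Finset.sum_le_sum fun I _ => hexchange Y I) (hW'.nonneg _)
    _ = _ := by
      rw [← Finset.sum_mul, hW'.sum_eq_one, one_mul, Finset.sum_const, Finset.card_univ,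
        Fintype.card_finset, nsmul_eq_mul]
      push_cast
      rfl

end Rows

/-! ### Sparse vectors orthogonal to all rows -/

section Sparse

variable {ι κ F : Type*} [Fintype ι] [DecidableEq ι] [Fintype κ] [DecidableEq κ] [Field F]
  [Fintype F] [DecidableEq F] {p : F → ℝ}

open scoped Classical in
/-- Union bound for sparse vectors in the common kernel. A vector with support `J` that is
orthogonal to suitable `|J|` of the rows can be chosen depending on these rows only, and the
remaining rows are independent of it. -/
theorem prob_exists_sparse_le (hp : IsProbVec p) {ρ : ℕ → ℝ} (hρ0 : ∀ s, 0 ≤ ρ s)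
    (hρ1 : ∀ s, ρ s ≤ 1)
    (hρ : ∀ v : ι → F, v ≠ 0 →
      prob (prodWeight p) (fun x : ι → F => x ⬝ᵥ v = 0) ≤ ρ (hammingNorm v)) (m : ℕ) :
    prob (prodWeight (prodWeight p)) (fun X : κ → ι → F =>
      ∃ w ∈ rowKer X, w ≠ 0 ∧ hammingNorm w ≤ m) ≤
      ∑ J : Finset ι with 1 ≤ J.card ∧ J.card ≤ m, ∑ _I : Finset κ with _I.card ≤ J.card,
        ρ J.card ^ (Fintype.card κ - J.card) := by
  let supp : (ι → F) → Finset ι := fun w => Finset.univ.filter fun i => w i ≠ 0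
  have hsupp : ∀ w, (supp w).card = hammingNorm w := fun w => rfl
  -- a vector of support `J` orthogonal to the rows in `I`, chosen as a function of these rows
  let pick : Finset ι → (I : Finset κ) → ({j // j ∈ I} → ι → F) → ι → F := fun J I X =>
    if h : ∃ w, supp w = J ∧ w ∈ rowKer X then h.choose else 0
  let ev : Finset ι → Finset κ → (κ → ι → F) → Prop := fun J I X =>
    supp (pick J I fun j => X j) = J ∧ ∀ j : {j // j ∉ I}, X j ⬝ᵥ pick J I (fun j => X j) = 0
  have hWp := hp.prodWeight (κ := ι)
  have hW := hWp.prodWeight (κ := κ)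
  have hcover : ∀ X : κ → ι → F, (∃ w ∈ rowKer X, w ≠ 0 ∧ hammingNorm w ≤ m) →
      ∃ J ∈ Finset.univ.filter (fun J : Finset ι => 1 ≤ J.card ∧ J.card ≤ m),
        ∃ I ∈ Finset.univ.filter (fun I : Finset κ => I.card ≤ J.card), ev J I X := by
    rintro X ⟨w, hw, hw0, hwm⟩
    -- the vectors supported in the support of `w`
    let E : Submodule F (ι → F) :=
      { carrier := {v | ∀ i, i ∉ supp w → v i = 0}
        zero_mem' := fun _ _ => rfl
        add_mem' := fun {a b} ha hb i hi => by simp [ha i hi, hb i hi]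
        smul_mem' := fun c a ha i hi => by simp [ha i hi] }
    obtain ⟨I, hI1, hI2⟩ := exists_subfamily_rowKer E X
    have hE : Module.finrank F E ≤ (supp w).card := by
      let R : E →ₗ[F] ({i // i ∈ supp w} → F) :=
        (LinearMap.funLeft F F (Subtype.val : {i // i ∈ supp w} → ι)).comp E.subtype
      have hR : Function.Injective R := by
        rw [← LinearMap.ker_eq_bot, LinearMap.ker_eq_bot']
        intro v hv
        apply Subtype.ext
        funext i
        by_cases hi : i ∈ supp w
        · exact congrFun hv ⟨i, hi⟩
        · exact v.2 i hi
      have := LinearMap.finrank_le_finrank_of_injective hR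
      simpa using this
    refine ⟨supp w, ?_, I, ?_, ?_⟩
    · rw [Finset.mem_filter, hsupp]
      exact ⟨Finset.mem_univ _, hammingNorm_pos_iff.2 hw0, hwm⟩
    · exact Finset.mem_filter.2 ⟨Finset.mem_univ _, by omega⟩
    · have hex : ∃ v, supp v = supp w ∧ v ∈ rowKer fun j : {j // j ∈ I} => X j :=
        ⟨w, rfl, fun j => hw j⟩
      have hpick : pick (supp w) I (fun j => X j) = hex.choose := dif_pos hex
      have hspec := hex.choose_spec
      rw [← hpick] at hspec
      refine ⟨hspec.1, fun j => ?_⟩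
      have : pick (supp w) I (fun j => X j) ∈ E ⊓ rowKer (fun j : {j // j ∈ I} => X j) := by
        refine ⟨fun i hi => ?_, hspec.2⟩
        rw [← hspec.1] at hi
        simpa [supp] using hi
      rw [hI2] at this
      exact this.2 j
  have hev : ∀ J I, 1 ≤ J.card → I.card ≤ J.card →
      prob (prodWeight (prodWeight p)) (ev J I) ≤ ρ J.card ^ (Fintype.card κ - J.card) := by
    intro J I hJ hIJ
    let term : ({j // j ∈ I} → ι → F) → ({j // j ∉ I} → ι → F) → ℝ := fun X X' =>
      if supp (pick J I X) = J ∧ ∀ j, X' j ⬝ᵥ pick J I X = 0 then 1 else 0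
    have hsp : ∑ X : κ → ι → F, prodWeight (prodWeight p) X *
        term (fun j => X j) (fun j => X j) = ∑ X : {j // j ∈ I} → ι → F,
          prodWeight (prodWeight p) X * ∑ X' : {j // j ∉ I} → ι → F,
            prodWeight (prodWeight p) X' * term X X' :=
      sum_prodWeight_split (V := ι → F) (prodWeight p) (fun j => j ∈ I) term
    have hWI := hWp.prodWeight (κ := {j // j ∈ I})
    have hin : ∀ X : {j // j ∈ I} → ι → F, ∑ X' : {j // j ∉ I} → ι → F,
        prodWeight (prodWeight p) X' * term X X' ≤ ρ J.card ^ (Fintype.card κ - J.card) := by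
      intro X
      by_cases hs : supp (pick J I X) = J
      · have h1 : ∑ X' : {j // j ∉ I} → ι → F, prodWeight (prodWeight p) X' * term X X' =
            prob (prodWeight (prodWeight p)) (fun X' : {j // j ∉ I} → ι → F =>
              ∀ j, X' j ⬝ᵥ pick J I X = 0) := by
          rw [prob_eq_sum_mul]
          simp only [term, hs, true_and]
        have h2 : hammingNorm (pick J I X) = J.card := by rw [← hsupp, hs]
        have h3 : pick J I X ≠ 0 := hammingNorm_pos_iff.1 (by omega)
        have h4 := hρ _ h3
        rw [h2] at h4
        rw [h1, prob_forall (κ := {j // j ∉ I}) (prodWeight p)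
          (fun x : ι → F => x ⬝ᵥ pick J I X = 0), Fintype.card_subtype_compl, Fintype.card_coe]
        exact (pow_le_pow_left₀ (prob_nonneg hWp _) h4 _).trans
          (pow_le_pow_of_le_one (hρ0 _) (hρ1 _) (by omega))
      · have h1 : ∀ X' : {j // j ∉ I} → ι → F, term X X' = 0 := fun X' =>
          if_neg fun h => hs h.1
        simp only [h1, mul_zero, Finset.sum_const_zero]
        exact pow_nonneg (hρ0 _) _
    rw [prob_eq_sum_mul]
    refine hsp.trans_le ?_
    calc _ ≤ ∑ X : {j // j ∈ I} → ι → F, prodWeight (prodWeight p) X *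
          ρ J.card ^ (Fintype.card κ - J.card) :=
          Finset.sum_le_sum fun X _ => mul_le_mul_of_nonneg_left (hin X) (hWI.nonneg _)
      _ = _ := by rw [← Finset.sum_mul, hWI.sum_eq_one, one_mul]
  refine (prob_mono hW hcover).trans ((prob_exists_le hW _ _).trans ?_)
  refine Finset.sum_le_sum fun J hJ => (prob_exists_le hW _ _).trans ?_
  exact Finset.sum_le_sum fun I hI =>
    hev J I (Finset.mem_filter.1 hJ).2.1 (Finset.mem_filter.1 hI).2

end Sparse

/-- The number of subsets of size at most `s`, by comparison with `∑ x ^ |I| = (1 + x) ^ n`. -/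
theorem card_small_subsets_mul_pow_le (α : Type*) [Fintype α] [DecidableEq α] (s : ℕ) {x : ℝ}
    (hx0 : 0 < x) (hx1 : x ≤ 1) :
    ((Finset.univ.filter fun I : Finset α => I.card ≤ s).card : ℝ) * x ^ s ≤
      Real.exp (x * Fintype.card α) := by
  have h1 : ∑ I : Finset α, x ^ I.card = (x + 1) ^ Fintype.card α := by
    have := Fintype.sum_pow_mul_eq_add_pow α x 1
    simpa using this
  calc _ = ∑ I : Finset α with I.card ≤ s, x ^ s := by simp
    _ ≤ ∑ I : Finset α with I.card ≤ s, x ^ I.card := Finset.sum_le_sum fun I hI =>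
        pow_le_pow_of_le_one hx0.le hx1 (Finset.mem_filter.1 hI).2
    _ ≤ ∑ I : Finset α, x ^ I.card := Finset.sum_le_sum_of_subset_of_nonneg
        (Finset.subset_univ _) fun _ _ _ => by positivity
    _ ≤ Real.exp (x * Fintype.card α) := by
      rw [h1, mul_comm, Real.exp_nat_mul]
      exact pow_le_pow_left₀ (by positivity) (Real.add_one_le_exp x) _

theorem card_small_subsets_le (α : Type*) [Fintype α] [DecidableEq α] (s : ℕ) {y : ℝ}
    (hy : 0 ≤ y) :
    ((Finset.univ.filter fun I : Finset α => I.card ≤ s).card : ℝ) ≤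
      Real.exp (Real.exp (-y) * Fintype.card α + y * s) := by
  have h := card_small_subsets_mul_pow_le α s (Real.exp_pos (-y))
    (Real.exp_le_one_iff.2 (by linarith))
  rw [← Real.exp_nat_mul] at h
  rw [Real.exp_add]
  have h2 : Real.exp (s * -y) * Real.exp (y * s) = 1 := by
    rw [← Real.exp_add]; simp; ring
  calc _ = ((Finset.univ.filter fun I : Finset α => I.card ≤ s).card : ℝ) *
        (Real.exp (s * -y) * Real.exp (y * s)) := by rw [h2, mul_one]
    _ ≤ _ := by
      rw [← mul_assoc]
      exact mul_le_mul_of_nonneg_right h (Real.exp_pos _).le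

/-- The summand of the sparse union bound with supports of size `s`. -/
theorem sparse_term_le {α : ℝ} (hα0 : 0 < α) (hα1 : α < 1) {n k s : ℕ} (hn : 1 ≤ n)
    (hk : n ≤ 2 * k) (hkn : k ≤ n) (hs1 : 1 ≤ s) (hs : 1000 * s ≤ n)
    (hlog : 640 * Real.log n ≤ α * n) {N₁ N₂ : ℝ} (hN₂0 : 0 ≤ N₂)
    (hN₁ : ∀ y, 0 ≤ y → N₁ ≤ Real.exp (Real.exp (-y) * n + y * s))
    (hN₂ : ∀ y, 0 ≤ y → N₂ ≤ Real.exp (Real.exp (-y) * k + y * s)) :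
    N₁ * N₂ * (1 / 2 + 1 / 2 * Real.exp (-(α * s / 10))) ^ (k - s) ≤
      Real.exp 2 * Real.exp (-(α * n / 320)) := by
  have hn' : (1 : ℝ) ≤ n := by exact_mod_cast hn
  have hk' : (n : ℝ) ≤ 2 * k := by exact_mod_cast hk
  have hkn' : (k : ℝ) ≤ n := by exact_mod_cast hkn
  have hs1' : (1 : ℝ) ≤ s := by exact_mod_cast hs1
  have hs' : 1000 * (s : ℝ) ≤ n := by exact_mod_cast hs
  have hks : (n : ℝ) / 4 ≤ ((k - s : ℕ) : ℝ) := by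
    rw [Nat.cast_sub (by omega)]; linarith
  have hρ0 : 0 ≤ 1 / 2 + 1 / 2 * Real.exp (-(α * s / 10)) := by positivity
  have hNN : ∀ y, 0 ≤ y → N₁ * N₂ ≤ Real.exp (2 * (Real.exp (-y) * n + y * s)) := by
    intro y hy
    have h1 : N₂ ≤ Real.exp (Real.exp (-y) * n + y * s) := (hN₂ y hy).trans
      (Real.exp_le_exp.2 (by nlinarith [Real.exp_pos (-y)]))
    rw [two_mul, Real.exp_add]
    exact mul_le_mul (hN₁ y hy) h1 hN₂0 (Real.exp_pos _).le
  rw [← Real.exp_add]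
  by_cases hcase : α * s ≤ 10
  · -- few non-zero coordinates: `ρ ≤ exp (-α s / 40)` against `n ^ (2 s)` choices
    have hρ : 1 / 2 + 1 / 2 * Real.exp (-(α * s / 10)) ≤ Real.exp (-(α * s / 40)) := by
      have hx0 : 0 ≤ α * s / 10 := by positivity
      have hx1 : α * s / 10 ≤ 1 := by linarith
      have h1 : Real.exp (-(α * s / 10)) ≤ 1 - α * s / 10 / 2 := by
        rw [Real.exp_neg, inv_le_comm₀ (Real.exp_pos _) (by linarith)]
        have h2 := Real.add_one_le_exp (α * s / 10)
        refine le_trans ?_ h2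
        rw [inv_le_iff_one_le_mul₀ (by linarith)]
        nlinarith
      have h2 := Real.add_one_le_exp (-(α * s / 40))
      linarith
    have h1 : (1 / 2 + 1 / 2 * Real.exp (-(α * s / 10))) ^ (k - s) ≤
        Real.exp (-(α * s / 160 * n)) := by
      refine (pow_le_pow_left₀ hρ0 hρ _).trans ?_
      rw [← Real.exp_nat_mul]
      refine Real.exp_le_exp.2 ?_
      have : 0 ≤ α * s / 40 := by positivity
      nlinarith
    -- the choice `y = log n` bounds the number of subsets of size `s` by `exp (1 + s log n)`
    have h2 := hNN (Real.log n) (Real.log_nonneg hn')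
    rw [Real.exp_neg, Real.exp_log (by linarith), inv_mul_cancel₀ (by linarith)] at h2
    refine (mul_le_mul h2 h1 (by positivity) (Real.exp_pos _).le).trans ?_
    rw [← Real.exp_add]
    refine Real.exp_le_exp.2 ?_
    nlinarith [mul_le_mul_of_nonneg_right hlog (by linarith : (0 : ℝ) ≤ s),
      mul_le_mul_of_nonneg_left hs1' (by positivity : 0 ≤ α * n)]
  · -- many non-zero coordinates: `ρ ≤ exp (-1 / 3)` against an entropy of at most `n / 25`
    push Not at hcase
    have he : Real.exp (-1) ≤ 0.37 := by
      have := Real.exp_neg_one_lt_d9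
      linarith
    have hρ : 1 / 2 + 1 / 2 * Real.exp (-(α * s / 10)) ≤ Real.exp (-(1 / 3)) := by
      have h1 : Real.exp (-(α * s / 10)) ≤ Real.exp (-1) := Real.exp_le_exp.2 (by linarith)
      have h2 : (0.7 : ℝ) ≤ Real.exp (-(1 / 3)) := by
        have h3 : Real.exp (-(1 / 3)) ^ 3 = Real.exp (-1) := by
          rw [← Real.exp_nat_mul]; norm_num
        have h4 := Real.exp_neg_one_gt_d9
        by_contra hlt
        push Not at hlt
        have := pow_le_pow_left₀ (Real.exp_pos _).le hlt.le 3
        rw [h3] at this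
        norm_num at this h4
        linarith
      linarith
    have h1 : (1 / 2 + 1 / 2 * Real.exp (-(α * s / 10))) ^ (k - s) ≤ Real.exp (-(n / 12)) := by
      refine (pow_le_pow_left₀ hρ0 hρ _).trans ?_
      rw [← Real.exp_nat_mul]
      refine Real.exp_le_exp.2 ?_
      linarith
    have h2 := hNN 5 (by norm_num)
    have h3 : Real.exp (-5) ≤ 0.01 := by
      have h4 : Real.exp (-5) = Real.exp (-1) ^ 5 := by
        rw [← Real.exp_nat_mul]; norm_num
      rw [h4]
      refine (pow_le_pow_left₀ (Real.exp_pos _).le he 5).trans ?_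
      norm_num
    refine (mul_le_mul h2 h1 (by positivity) (Real.exp_pos _).le).trans ?_
    rw [← Real.exp_add]
    refine Real.exp_le_exp.2 ?_
    nlinarith

section Sparse

variable {ι κ F : Type*} [Fintype ι] [DecidableEq ι] [Fintype κ] [DecidableEq κ] [Field F]
  [Fintype F] [DecidableEq F] {ψ : AddChar F ℂ} {p : F → ℝ}

theorem prob_exists_sparse_le_exp (hp : IsProbVec p) (hψ : ψ ≠ 1) {α : ℝ} (hα0 : 0 < α)
    (hα1 : α < 1) (hα : DenseWeight α p) (hn : 1 ≤ Fintype.card ι)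
    (hk : Fintype.card ι ≤ 2 * Fintype.card κ) (hkn : Fintype.card κ ≤ Fintype.card ι)
    (hlog : 640 * Real.log (Fintype.card ι) ≤ α * Fintype.card ι) :
    prob (prodWeight (prodWeight p)) (fun X : κ → ι → F =>
      ∃ w ∈ rowKer X, w ≠ 0 ∧ 1000 * hammingNorm w ≤ Fintype.card ι) ≤
      Real.exp 2 * Real.exp (-(α * Fintype.card ι / 640)) := by
  classical
  set n := Fintype.card ι with hn_def
  set k := Fintype.card κ with hk_def
  set m := n / 1000 with hm
  let ρ : ℕ → ℝ := fun s => 1 / 2 + 1 / 2 * Real.exp (-(α * s / 10))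
  have h1 := prob_exists_sparse_le (ι := ι) (κ := κ) hp (ρ := ρ) (fun s => by positivity)
    (fun s => by
      have : Real.exp (-(α * s / 10)) ≤ 1 := Real.exp_le_one_iff.2 (by
        have : 0 ≤ α * s / 10 := by positivity
        linarith)
      simp only [ρ]; linarith)
    (fun v hv => prob_dotProduct_eq_zero_le hp hψ hα0 hα hv) m
  have hW : IsProbVec (prodWeight (prodWeight p) : (κ → ι → F) → ℝ) :=
    hp.prodWeight.prodWeight
  refine (prob_mono hW ?_).trans (h1.trans ?_)
  · rintro (X : κ → ι → F) ⟨w, hw, hw0, hwm⟩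
    exact ⟨w, hw, hw0, by omega⟩
  · simp only [Finset.sum_const, nsmul_eq_mul]
    rw [← Finset.sum_fiberwise_of_maps_to (s := Finset.univ.filter
      (fun J : Finset ι => 1 ≤ J.card ∧ J.card ≤ m)) (t := Finset.Icc 1 m) (g := Finset.card)
      (fun J hJ => Finset.mem_Icc.2 (Finset.mem_filter.1 hJ).2)]
    have hs : ∀ s ∈ Finset.Icc 1 m,
        ∑ J ∈ (Finset.univ.filter (fun J : Finset ι => 1 ≤ J.card ∧ J.card ≤ m)).filter
          (fun J => J.card = s), ((Finset.univ.filter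
            fun I : Finset κ => I.card ≤ J.card).card : ℝ) * ρ J.card ^ (k - J.card) ≤
        Real.exp 2 * Real.exp (-(α * n / 320)) := by
      intro s hs
      rw [Finset.mem_Icc] at hs
      have hsub : (Finset.univ.filter (fun J : Finset ι => 1 ≤ J.card ∧ J.card ≤ m)).filter
          (fun J => J.card = s) ⊆ Finset.univ.filter (fun J : Finset ι => J.card ≤ s) := by
        intro J hJ
        simp only [Finset.mem_filter, Finset.mem_univ, true_and] at hJ ⊢
        omega
      rw [Finset.sum_congr rfl (g := fun _ => ((Finset.univ.filter
            fun I : Finset κ => I.card ≤ s).card : ℝ) * ρ s ^ (k - s)) (fun J hJ => by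
          rw [(Finset.mem_filter.1 hJ).2]), Finset.sum_const, nsmul_eq_mul, ← mul_assoc]
      have hρs : 0 ≤ ρ s := by positivity
      refine le_trans ?_ (sparse_term_le hα0 hα1 (s := s) hn hk hkn hs.1 (by omega) hlog
        (Nat.cast_nonneg _) (fun y hy => card_small_subsets_le ι s hy)
        (fun y hy => card_small_subsets_le κ s hy))
      refine mul_le_mul_of_nonneg_right (mul_le_mul_of_nonneg_right ?_ (Nat.cast_nonneg _))
        (pow_nonneg hρs _)
      exact_mod_cast Finset.card_le_card hsub
    refine (Finset.sum_le_card_nsmul _ _ _ hs).trans ?_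
    rw [Nat.card_Icc, nsmul_eq_mul]
    have hn' : (0 : ℝ) < n := by exact_mod_cast hn
    have hmn : ((m + 1 - 1 : ℕ) : ℝ) ≤ Real.exp (α * n / 640) := by
      calc ((m + 1 - 1 : ℕ) : ℝ) ≤ n := by
            exact_mod_cast (by omega : m + 1 - 1 ≤ n)
        _ = Real.exp (Real.log n) := (Real.exp_log hn').symm
        _ ≤ _ := Real.exp_le_exp.2 (by linarith)
    calc ((m + 1 - 1 : ℕ) : ℝ) * (Real.exp 2 * Real.exp (-(α * n / 320)))
        ≤ Real.exp (α * n / 640) * (Real.exp 2 * Real.exp (-(α * n / 320))) :=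
          mul_le_mul_of_nonneg_right hmn (by positivity)
      _ = _ := by
        rw [mul_left_comm, ← Real.exp_add]
        congr 2
        ring

end Sparse

/-! ### Counting vectors with small total defect -/

section Count

variable {ι κ F : Type*} [Fintype ι] [DecidableEq ι] [Field F] [Fintype F] [DecidableEq F]
  {ψ : AddChar F ℂ} {p : F → ℝ}

omit [DecidableEq F] in
/-- Exponential Markov inequality for the number of vectors of small total defect. -/
theorem card_sublevel_totalDefect_mul_le (u : ℝ) {t : ℝ} (ht : 0 ≤ t) :
    ((sublevel (totalDefect (ι := ι) ψ p) u).card : ℝ) * Real.exp (-(t * u)) ≤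
      (∑ x, Real.exp (-(t * defect ψ p x))) ^ Fintype.card ι := by
  have h1 : (∑ x, Real.exp (-(t * defect ψ p x))) ^ Fintype.card ι =
      ∑ w : ι → F, Real.exp (-(t * totalDefect ψ p w)) := by
    rw [← Finset.card_univ, ← Finset.prod_const, Finset.prod_univ_sum, Fintype.piFinset_univ]
    refine Finset.sum_congr rfl fun w _ => ?_
    rw [← Real.exp_sum, Finset.sum_neg_distrib, ← Finset.mul_sum, totalDefect]
  rw [h1, ← nsmul_eq_mul, ← Finset.sum_const]
  refine (Finset.sum_le_sum fun w hw => Real.exp_le_exp.2 ?_).trans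
    (Finset.sum_le_sum_of_subset_of_nonneg (Finset.subset_univ _) fun _ _ _ =>
      (Real.exp_pos _).le)
  exact neg_le_neg (mul_le_mul_of_nonneg_left (mem_sublevel.1 hw) ht)

omit [DecidableEq F] in
/-- Sublevel sets of the defect on `F` below the scale `α` are trivial or sparse. -/
theorem card_sublevel_defect (hp : IsProbVec p) (hψ : ψ ≠ 1) {α : ℝ} (hα0 : 0 < α)
    (hα : DenseWeight α p) (i : ℕ) :
    (∀ x, defect ψ p x ≤ α / 16 ^ i → x = 0) ∨
      2 ^ i * (sublevel (defect ψ p) (α / 16 ^ i)).card ≤ Fintype.card F := by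
  classical
  have hS : IsSquaredSeminorm (defect ψ p) :=
    ⟨defect_nonneg hp, defect_zero, defect_neg, fun x y _ _ hi hj => defect_add_le hp x y hi hj⟩
  have hL : LargeOnSubgroups (defect ψ p) α := by
    intro H hH
    obtain ⟨g, hg, hg0⟩ := (AddSubgroup.bot_or_exists_ne_zero H).resolve_left hH
    by_contra hlt
    push Not at hlt
    have h1 : ∑ h : H, defect ψ p (H.subtype h) < ∑ _h : H, α :=
      Finset.sum_lt_sum_of_nonempty ⟨0, Finset.mem_univ _⟩ fun h _ => hlt h h.2
    have h2 := sum_defect_ge hp hψ hα H.subtype ⟨⟨g, hg⟩, hg0⟩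
    simp only [Finset.sum_const, Finset.card_univ, nsmul_eq_mul] at h1
    linarith
  have h16 : (0 : ℝ) < 16 ^ i := by positivity
  rcases card_sublevel_growth hS hL hα0 (u := α / 16 ^ i) (by positivity) i
    (by rw [mul_div_cancel₀ _ h16.ne']) with h | h
  · exact Or.inl fun x hx => h x (mem_sublevel.2 hx)
  · exact Or.inr (h.trans (Finset.card_le_univ _))

open scoped Classical in
/-- Non-sparse vectors of small total defect form an exponentially small proportion of all
vectors. -/
theorem card_structured_le (hp : IsProbVec p) (hψ : ψ ≠ 1) {α : ℝ} (hα0 : 0 < α)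
    (hα : DenseWeight α p) (i : ℕ) :
    ((Finset.univ.filter fun w : ι → F => Fintype.card ι < 1000 * hammingNorm w ∧
        totalDefect ψ p w ≤ Fintype.card ι * (α / 16 ^ i) / 1000).card : ℝ) ≤
      (Fintype.card F * (Real.exp 1 * ((2 ^ i)⁻¹ + Real.exp (-1000)))) ^ Fintype.card ι := by
  set n := Fintype.card ι
  set τ := α / 16 ^ i with hτ
  have hτ0 : 0 < τ := by positivity
  rcases card_sublevel_defect hp hψ hα0 hα i with h | h
  · -- only `0` has defect at most `τ`, so a non-sparse vector has a large total defect
    rw [Finset.filter_false_of_mem]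
    · simp only [Finset.card_empty, Nat.cast_zero]; positivity
    · rintro w - ⟨h1, h2⟩
      have h3 : (hammingNorm w : ℝ) * τ ≤ totalDefect ψ p w := by
        have h4 : (hammingNorm w : ℝ) * τ = ∑ i with w i ≠ 0, τ := by
          rw [Finset.sum_const, nsmul_eq_mul]; rfl
        rw [h4]
        refine le_trans (Finset.sum_le_sum fun i hi => ?_) (Finset.sum_le_sum_of_subset_of_nonneg
          (Finset.subset_univ _) fun i _ _ => defect_nonneg hp _)
        by_contra hlt
        exact (Finset.mem_filter.1 hi).2 (h _ (not_le.1 hlt).le)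
      have h5 : (n : ℝ) < 1000 * hammingNorm w := by exact_mod_cast h1
      nlinarith
  · -- otherwise the exponential Markov inequality, with the exponent `1000 / τ` that makes the
    -- points of defect above `τ` negligible
    set q : ℝ := (Fintype.card F : ℝ) with hq
    have hB : ((sublevel (defect ψ p) τ).card : ℝ) ≤ q * (2 ^ i)⁻¹ := by
      have h' := (Nat.cast_le (α := ℝ)).2 h
      push_cast at h'
      rw [← div_eq_mul_inv, le_div_iff₀ (by positivity), mul_comm]
      exact h'
    have hsum : ∑ x, Real.exp (-(1000 / τ * defect ψ p x)) ≤
        q * ((2 ^ i)⁻¹ + Real.exp (-1000)) := by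
      have h1 : ∀ x, Real.exp (-(1000 / τ * defect ψ p x)) ≤
          (if x ∈ sublevel (defect ψ p) τ then 1 else 0) + Real.exp (-1000) := by
        intro x
        split_ifs with hx
        · have := Real.exp_le_one_iff.2 (show -(1000 / τ * defect ψ p x) ≤ 0 by
            have := defect_nonneg (ψ := ψ) hp x
            have : 0 ≤ 1000 / τ * defect ψ p x := by positivity
            linarith)
          linarith [Real.exp_pos (-1000)]
        · rw [mem_sublevel, not_le] at hx
          rw [zero_add]
          refine Real.exp_le_exp.2 (neg_le_neg ?_)
          rw [div_mul_eq_mul_div, le_div_iff₀ hτ0]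
          linarith
      refine (Finset.sum_le_sum fun x _ => h1 x).trans ?_
      rw [Finset.sum_add_distrib, Finset.sum_ite_mem]
      simp only [Finset.sum_const, Finset.card_univ, nsmul_eq_mul, Finset.univ_inter, mul_one]
      rw [mul_add]
      linarith
    have h1 := card_sublevel_totalDefect_mul_le (ι := ι) (ψ := ψ) (p := p) (n * τ / 1000)
      (t := 1000 / τ) (by positivity)
    have h2 : 1000 / τ * (n * τ / 1000) = n := by field_simp
    rw [h2] at h1
    have h3 : ((Finset.univ.filter fun w : ι → F => n < 1000 * hammingNorm w ∧
        totalDefect ψ p w ≤ n * τ / 1000).card : ℝ) ≤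
        (sublevel (totalDefect (ι := ι) ψ p) (n * τ / 1000)).card := by
      refine Nat.cast_le.2 (Finset.card_le_card fun w hw => ?_)
      exact mem_sublevel.2 (Finset.mem_filter.1 hw).2.2
    refine h3.trans ?_
    have h4 : Real.exp (-(n : ℝ)) * Real.exp 1 ^ n = 1 := by
      rw [← Real.exp_nat_mul, ← Real.exp_add]; simp
    have h5 : (∑ x, Real.exp (-(1000 / τ * defect ψ p x))) ^ n ≤
        (q * ((2 ^ i)⁻¹ + Real.exp (-1000))) ^ n :=
      pow_le_pow_left₀ (Finset.sum_nonneg fun _ _ => (Real.exp_pos _).le) hsum n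
    calc ((sublevel (totalDefect (ι := ι) ψ p) (n * τ / 1000)).card : ℝ)
        = (sublevel (totalDefect (ι := ι) ψ p) (n * τ / 1000)).card * Real.exp (-(n : ℝ)) *
          Real.exp 1 ^ n := by rw [mul_assoc, h4, mul_one]
      _ ≤ (q * ((2 ^ i)⁻¹ + Real.exp (-1000))) ^ n * Real.exp 1 ^ n :=
        mul_le_mul_of_nonneg_right (h1.trans h5) (by positivity)
      _ = _ := by rw [← mul_pow]; congr 1; ring

open scoped Classical in
/-- First moment of the number of vectors of `Z` orthogonal to all rows. -/
theorem sum_card_rowKer_inter_le [Fintype κ] [DecidableEq κ] (hp : IsProbVec p)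
    (Z : Finset (ι → F)) {ρ : ℝ}
    (hZ : ∀ w ∈ Z, prob (prodWeight p) (fun x : ι → F => x ⬝ᵥ w = 0) ≤ ρ) :
    ∑ X : κ → ι → F, prodWeight (prodWeight p) X * ((Z.filter fun w => w ∈ rowKer X).card : ℝ) ≤
      Z.card * ρ ^ Fintype.card κ := by
  have h1 : ∀ X : κ → ι → F, prodWeight (prodWeight p) X *
      ((Z.filter fun w => w ∈ rowKer X).card : ℝ) =
        ∑ w ∈ Z, prodWeight (prodWeight p) X * (if ∀ j, X j ⬝ᵥ w = 0 then 1 else 0) := by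
    intro X
    rw [Finset.card_filter, ← Finset.mul_sum]
    push_cast
    simp only [mem_rowKer]
  simp_rw [h1]
  rw [Finset.sum_comm, ← nsmul_eq_mul, ← Finset.sum_const]
  refine Finset.sum_le_sum fun w hw => ?_
  rw [← prob_eq_sum_mul, prob_forall (κ := κ) (prodWeight p) (fun x : ι → F => x ⬝ᵥ w = 0)]
  exact pow_le_pow_left₀ (prob_nonneg hp.prodWeight _) (hZ w hw) _

end Count

/-! ### The expected Fourier error -/

section Main

variable {ι κ F : Type*} [Fintype ι] [DecidableEq ι] [Fintype κ] [DecidableEq κ] [Field F]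
  [Fintype F] [DecidableEq F] {ψ : AddChar F ℂ} {p : F → ℝ}

omit [DecidableEq F] in
theorem DenseWeight.apply_le {α : ℝ} (hα : DenseWeight α p) (y : F) : p y ≤ 1 - α := by
  have h := hα ⊥ bot_ne_top y
  have : prob p (fun x => x - y ∈ (⊥ : AddSubgroup F)) = p y := by
    classical
    simp [prob, AddSubgroup.mem_bot, sub_eq_zero]
  rwa [this] at h

/-- If a lazy row is orthogonal to `G` with probability below `K / |G|`, then a row is orthogonal
to any non-zero vector of `G` with probability at most `K / |F|`. -/
theorem card_mul_prob_dotProduct_le (hp : IsProbVec p) (hψ : ψ ≠ 1) {β : ℝ} (hβ0 : 0 ≤ β)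
    (hβ1 : β ≤ 1 / 4) (G : Submodule F (ι → F)) {w : ι → F} (hw : w ∈ G) (hw0 : w ≠ 0) :
    (Fintype.card F : ℝ) * prob (prodWeight p) (fun x : ι → F => x ⬝ᵥ w = 0) ≤
      Nat.card G * prob (prodWeight (lazyWeight β p)) (fun x : ι → F => Kills x G) := by
  classical
  rw [card_mul_prob_kills_lazy hp hψ]
  set q : ℝ := (Fintype.card F : ℝ) with hq
  have hq0 : 0 < q := Nat.cast_pos.2 Fintype.card_pos
  have h1 := (abs_le.1 (abs_prob_dotProduct_eq_sub_le hp hψ w 0)).2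
  have hfac : ∀ v : ι → F, 0 ≤ ∏ i, (1 - β * defect ψ p (v i)) := fun v =>
    (Real.exp_pos _).le.trans (exp_le_prod_lazy hp hβ0 (by linarith) v)
  have hle : ∀ v : ι → F, ∏ i, ‖charFn ψ p (v i)‖ ≤ ∏ i, (1 - β * defect ψ p (v i)) := by
    intro v
    refine (prod_norm_charFn_le hp v).trans (le_trans (Real.exp_le_exp.2 (neg_le_neg ?_))
      (exp_le_prod_lazy hp hβ0 (by linarith) v))
    have : 0 ≤ totalDefect ψ p v := Finset.sum_nonneg fun i _ => defect_nonneg hp _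
    nlinarith
  have h2 : q * prob (prodWeight p) (fun x : ι → F => x ⬝ᵥ w = 0) ≤
      1 + ∑ a ∈ Finset.univ.filter (fun a : F => a ≠ 0), ∏ i, ‖charFn ψ p (a * w i)‖ := by
    have := mul_le_mul_of_nonneg_left h1 hq0.le
    rw [mul_sub, mul_inv_cancel_left₀ hq0.ne', mul_inv_cancel₀ hq0.ne'] at this
    linarith
  have h3 : 1 + ∑ a ∈ Finset.univ.filter (fun a : F => a ≠ 0), ∏ i, ‖charFn ψ p (a * w i)‖ ≤
      ∑ a : F, ∏ i, (1 - β * defect ψ p ((a • w) i)) := by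
    rw [Finset.filter_ne', ← Finset.add_sum_erase _ _ (Finset.mem_univ (0 : F))]
    refine add_le_add ?_ (Finset.sum_le_sum fun a _ => hle (a • w))
    simp [defect_zero]
  refine h2.trans (h3.trans ?_)
  let f : F → G := fun a => ⟨a • w, G.smul_mem a hw⟩
  have hf : Function.Injective f := by
    intro a b hab
    have h4 : a • w = b • w := congrArg Subtype.val hab
    exact smul_left_injective F hw0 h4
  calc ∑ a : F, ∏ i, (1 - β * defect ψ p ((a • w) i))
      = ∑ v ∈ Finset.univ.image f, ∏ i, (1 - β * defect ψ p (v.1 i)) := by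
        rw [Finset.sum_image fun a _ b _ h => hf h]
    _ ≤ _ := Finset.sum_le_sum_of_subset_of_nonneg (Finset.subset_univ _) fun v _ _ => hfac _

/-- The laziness parameter `1 / (4 * 16 ^ 11)`, coming from eleven doublings of the sublevel sets:
a gain of order `2 ^ (-11)` for each of `⌈n / 4⌉` exchanged rows outweighs the number `2 ^ n` of
sets of rows. -/
noncomputable def lazyParam : ℝ := (4 * 16 ^ 11)⁻¹

/-- The subspaces `G` without sparse vectors to which a lazy row is orthogonal with probability
neither exponentially small nor comparable to `1 / |G|`. -/
def IsUnsaturated (p : F → ℝ) (ε : ℝ) (G : Submodule F (ι → F)) : Prop :=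
  (∀ w ∈ G, w ≠ 0 → Fintype.card ι < 1000 * hammingNorm w) ∧
    ε < prob (prodWeight (lazyWeight lazyParam p)) (fun x : ι → F => Kills x G) ∧
    2 ^ 11 ≤ Nat.card G *
      prob (prodWeight (lazyWeight lazyParam p)) (fun x : ι → F => Kills x G)

theorem fourierError_le_of_nonsparse (hp : IsProbVec p) (hψ : ψ ≠ 1) {α : ℝ} (hα0 : 0 < α)
    (hα : DenseWeight α p) (hn : 1 ≤ Fintype.card ι)
    (hN : 16 ^ 16 * 2000 ≤ α * Fintype.card ι) {G : Submodule F (ι → F)}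
    (hG : ∀ w ∈ G, w ≠ 0 → Fintype.card ι < 1000 * hammingNorm w) :
    fourierError ψ p G ≤ 2 * (2 ^ 11)⁻¹ *
      prob (prodWeight (lazyWeight lazyParam p)) (fun x : ι → F => Kills x G) := by
  have hn' : (1 : ℝ) ≤ Fintype.card ι := by exact_mod_cast hn
  have h := fourierError_le_lazy hp hψ hα0 hα (m := (Fintype.card ι : ℝ) / 1000) (by positivity)
    (j := 11) (by norm_num) G (fun w hw hw0 => by
      have : (Fintype.card ι : ℝ) < 1000 * hammingNorm w := by exact_mod_cast hG w hw hw0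
      linarith)
  refine h.trans (mul_le_mul_of_nonneg_right ?_ (prob_nonneg
    (lazyWeight_isProbVec hp (by positivity) (by norm_num)).prodWeight _))
  have h1 : Real.exp (-(α * ((Fintype.card ι : ℝ) / 1000) / 16 ^ 11 / 4)) ≤ (2 ^ 11)⁻¹ := by
    have h2 : Real.exp (-(α * ((Fintype.card ι : ℝ) / 1000) / 16 ^ 11 / 4)) ≤ Real.exp (-11) := by
      refine Real.exp_le_exp.2 (neg_le_neg ?_)
      rw [le_div_iff₀ (by norm_num), le_div_iff₀ (by norm_num)]
      norm_num at hN ⊢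
      linarith
    refine h2.trans ?_
    rw [Real.exp_neg]
    refine inv_anti₀ (by positivity) ?_
    have h3 : Real.exp 11 = Real.exp 1 ^ 11 := by rw [← Real.exp_nat_mul]; norm_num
    rw [h3]
    exact pow_le_pow_left₀ (by norm_num) (by linarith [Real.add_one_le_exp 1]) 11
  linarith

theorem prob_unsaturated_le (hp : IsProbVec p) (hψ : ψ ≠ 1) {α : ℝ} (hα0 : 0 < α)
    (hα1 : α < 1) (hα : DenseWeight α p) (hn : 1 ≤ Fintype.card ι)
    (hN : 16 ^ 16 * 2000 ≤ α * Fintype.card ι) (hkn : Fintype.card κ ≤ Fintype.card ι) :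
    prob (prodWeight (prodWeight p)) (fun X : κ → ι → F =>
      Module.finrank F (rowKer X) + Fintype.card κ = Fintype.card ι ∧
        IsUnsaturated p (Real.exp (-(lazyParam * α * Fintype.card ι / 8))) (rowKer X)) ≤
      Real.exp (-(α * Fintype.card ι / 2)) := by
  set n := Fintype.card ι with hn_def
  have hn' : (1 : ℝ) ≤ n := by exact_mod_cast hn
  have hβ0 : 0 < lazyParam := by unfold lazyParam; positivity
  have hβ1 : lazyParam ≤ 1 / 2 := by unfold lazyParam; norm_num
  have hlazy := lazyWeight_isProbVec hp hβ0.le (by linarith : lazyParam ≤ 1)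
  have h := prob_rowKer_bad_le (ι := ι) (κ := κ) hp hlazy
    (IsUnsaturated p (Real.exp (-(lazyParam * α * n / 8)))) ((n + 3) / 4) (c := 3 * (2 ^ 11)⁻¹)
    (by positivity) (fun G hG => (Real.exp_pos _).trans hG.2.1)
    (fun G hG => by
      have h1 := prob_kills_le hp hψ G
      have h2 := fourierError_le_of_nonsparse hp hψ hα0 hα hn hN hG.1
      have h3 := hG.2.2
      have hc := card_submodule_pos G
      set Q := prob (prodWeight (lazyWeight lazyParam p)) (fun x : ι → F => Kills x G)
      have h4 : (Nat.card G : ℝ)⁻¹ ≤ (2 ^ 11)⁻¹ * Q := by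
        rw [inv_le_iff_one_le_mul₀ hc, mul_assoc, ← div_eq_inv_mul, le_div_iff₀ (by positivity)]
        linarith
      linarith)
    (fun G hG E hE => by
      have h1 := prob_kills_le_pow hlazy (a := lazyParam * α)
        (lazyWeight_le hp hα.apply_le hβ0.le hβ1) E
      refine h1.trans ?_
      have h2 := hG.2.1
      have h3 : (1 - lazyParam * α) ≤ Real.exp (-(lazyParam * α)) := by
        linarith [Real.add_one_le_exp (-(lazyParam * α))]
      have h4 : 0 ≤ 1 - lazyParam * α := by nlinarith
      have hE' : (n : ℝ) / 2 ≤ Module.finrank F E := by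
        rw [div_le_iff₀ (by norm_num)]
        exact_mod_cast (by omega : n ≤ Module.finrank F E * 2)
      have h5 : (1 - lazyParam * α) ^ Module.finrank F E ≤
          Real.exp (-(lazyParam * α * n / 2)) := by
        refine (pow_le_pow_left₀ h4 h3 _).trans ?_
        rw [← Real.exp_nat_mul]
        refine Real.exp_le_exp.2 ?_
        have : 0 ≤ lazyParam * α := by positivity
        nlinarith
      have h6 : Real.exp (-(lazyParam * α * n / 2)) ≤
          Real.exp (-(lazyParam * α * n / 8)) / 2 := by
        have h7 : Real.exp (-(lazyParam * α * n / 2)) =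
            Real.exp (-(lazyParam * α * n / 8)) * Real.exp (-(lazyParam * α * n * (3 / 8))) := by
          rw [← Real.exp_add]; congr 1; ring
        have h8 : Real.exp (-(lazyParam * α * n * (3 / 8))) ≤ 1 / 2 := by
          have h9 : (1 : ℝ) ≤ lazyParam * α * n * (3 / 8) := by
            unfold lazyParam
            norm_num at hN ⊢
            linarith
          rw [Real.exp_neg, one_div]
          refine inv_anti₀ (by norm_num) ?_
          linarith [Real.add_one_le_exp (lazyParam * α * n * (3 / 8))]
        rw [h7]
        nlinarith [Real.exp_pos (-(lazyParam * α * n / 8))]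
      linarith)
  refine h.trans ?_
  have h1 : (2 : ℝ) ^ Fintype.card κ ≤ 2 ^ n := pow_le_pow_right₀ (by norm_num) hkn
  have h2 : (2 * (3 * (2 ^ 11)⁻¹) : ℝ) ^ ((n + 3) / 4) ≤ ((2 : ℝ) ^ (2 * n))⁻¹ := by
    calc (2 * (3 * (2 ^ 11)⁻¹) : ℝ) ^ ((n + 3) / 4) ≤ ((2 ^ 8 : ℝ)⁻¹) ^ ((n + 3) / 4) :=
          pow_le_pow_left₀ (by positivity) (by norm_num) _
      _ = ((2 : ℝ) ^ (8 * ((n + 3) / 4)))⁻¹ := by rw [inv_pow, pow_mul]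
      _ ≤ _ := inv_anti₀ (by positivity) (pow_le_pow_right₀ (by norm_num) (by omega))
  have h3 : (2 : ℝ)⁻¹ ≤ Real.exp (-(1 / 2)) := by
    rw [Real.exp_neg]
    refine inv_anti₀ (Real.exp_pos _) ?_
    have h4 : Real.exp (1 / 2) ^ 2 = Real.exp 1 := by rw [← Real.exp_nat_mul]; norm_num
    have h5 := Real.exp_one_lt_d9
    nlinarith [Real.exp_pos (1 / 2)]
  calc (2 : ℝ) ^ Fintype.card κ * (2 * (3 * (2 ^ 11)⁻¹)) ^ ((n + 3) / 4)
      ≤ 2 ^ n * ((2 : ℝ) ^ (2 * n))⁻¹ := mul_le_mul h1 h2 (by positivity) (by positivity)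
    _ = (2 : ℝ)⁻¹ ^ n := by
      rw [two_mul, pow_add, mul_inv, ← mul_assoc, mul_inv_cancel₀ (by positivity), one_mul,
        inv_pow]
    _ ≤ Real.exp (-(1 / 2)) ^ n := pow_le_pow_left₀ (by norm_num) h3 n
    _ ≤ _ := by
      rw [← Real.exp_nat_mul]
      refine Real.exp_le_exp.2 ?_
      nlinarith

open scoped Classical in
/-- For a subspace without sparse vectors that is not unsaturated, the Fourier error is governed by
the number of its vectors of small total defect. -/
theorem fourierError_le_of_saturated (hp : IsProbVec p) (hψ : ψ ≠ 1) {α : ℝ} (hα0 : 0 < α)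
    (hα : DenseWeight α p) (hn : 1 ≤ Fintype.card ι)
    (hN : 16 ^ 16 * 2000 ≤ α * Fintype.card ι) {G : Submodule F (ι → F)} {ε : ℝ} (hε : 0 ≤ ε)
    (hG : ∀ w ∈ G, w ≠ 0 → Fintype.card ι < 1000 * hammingNorm w)
    (hsat : ¬ IsUnsaturated p ε G) (u : ℝ) {Z : Finset (ι → F)}
    (hZ : ∀ w, Fintype.card ι < 1000 * hammingNorm w → totalDefect ψ p w ≤ u →
      prob (prodWeight p) (fun x : ι → F => x ⬝ᵥ w = 0) ≤ 2 ^ 11 / Fintype.card F → w ∈ Z) :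
    fourierError ψ p G ≤ ε + Real.exp (-(u / 2)) +
      (Nat.card G : ℝ)⁻¹ * ((Z.filter fun w => w ∈ G).card : ℝ) := by
  have h1 := fourierError_le_of_nonsparse hp hψ hα0 hα hn hN hG
  have hc := card_submodule_pos G
  set Q := prob (prodWeight (lazyWeight lazyParam p)) (fun x : ι → F => Kills x G) with hQ
  by_cases hQε : Q ≤ ε
  · have h2 : fourierError ψ p G ≤ ε := by
      refine h1.trans ?_
      nlinarith
    have : 0 ≤ (Nat.card G : ℝ)⁻¹ * ((Z.filter fun w => w ∈ G).card : ℝ) := by positivity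
    linarith [Real.exp_pos (-(u / 2))]
  · have hQ2 : Nat.card G * Q < 2 ^ 11 := by
      by_contra hlt
      exact hsat ⟨hG, not_le.1 hQε, not_lt.1 hlt⟩
    have hq0 : (0 : ℝ) < Fintype.card F := Nat.cast_pos.2 Fintype.card_pos
    have h2 : ∀ w ∈ (Finset.univ : Finset G).erase 0, ∏ i, ‖charFn ψ p (w.1 i)‖ ≤
        Real.exp (-(u / 2)) + if w.1 ∈ Z then 1 else 0 := by
      intro w hw
      have hw0 : w.1 ≠ 0 := fun h => (Finset.mem_erase.1 hw).1 (Subtype.ext h)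
      split_ifs with hwZ
      · have := Finset.prod_le_one (s := Finset.univ) (f := fun i => ‖charFn ψ p (w.1 i)‖)
          (fun _ _ => norm_nonneg _) fun i _ => norm_charFn_le_one hp _
        linarith [Real.exp_pos (-(u / 2))]
      · rw [add_zero]
        refine (prod_norm_charFn_le hp _).trans (Real.exp_le_exp.2 ?_)
        have h3 : u < totalDefect ψ p w.1 := by
          by_contra hlt
          refine hwZ (hZ w.1 (hG _ w.2 hw0) (not_lt.1 hlt) ?_)
          rw [le_div_iff₀' hq0]
          exact (card_mul_prob_dotProduct_le hp hψ (by unfold lazyParam; positivity)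
            (by unfold lazyParam; norm_num) G w.2 hw0).trans hQ2.le
        linarith
    have h3 : Nat.card G * fourierError ψ p G ≤ Nat.card G * Real.exp (-(u / 2)) +
        ((Z.filter fun w => w ∈ G).card : ℝ) := by
      rw [card_mul_fourierError hp]
      refine (Finset.sum_le_sum h2).trans ?_
      refine (Finset.sum_le_sum_of_subset_of_nonneg (Finset.subset_univ _) fun w _ _ => by
        split_ifs <;> positivity).trans ?_
      rw [Finset.sum_add_distrib, Finset.sum_const, Finset.card_univ, nsmul_eq_mul,
        Nat.card_eq_fintype_card]
      refine add_le_add le_rfl ?_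
      rw [← Finset.sum_filter, Finset.sum_const, nsmul_eq_mul, mul_one, Nat.cast_le]
      refine Finset.card_le_card_of_injOn Subtype.val (fun w hw => ?_)
        (Subtype.val_injective.injOn)
      simp only [Finset.coe_filter, Finset.mem_univ, true_and, Set.mem_ofPred_eq] at hw ⊢
      exact ⟨hw, w.2⟩
    have h4 : fourierError ψ p G ≤ Real.exp (-(u / 2)) +
        (Nat.card G : ℝ)⁻¹ * ((Z.filter fun w => w ∈ G).card : ℝ) := by
      refine le_of_mul_le_mul_left (h3.trans_eq ?_) hc
      rw [mul_add, mul_inv_cancel_left₀ hc.ne']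
    linarith

open scoped Classical in
/-- The rate of decay of the expected Fourier error. -/
theorem sum_fourierError_le (hp : IsProbVec p) (hψ : ψ ≠ 1) {α : ℝ} (hα0 : 0 < α)
    (hα1 : α < 1) (hα : DenseWeight α p) (hn : 1 ≤ Fintype.card ι)
    (hk : Fintype.card ι ≤ 2 * Fintype.card κ) (hkn : Fintype.card κ ≤ Fintype.card ι)
    (hlog : 640 * Real.log (Fintype.card ι) ≤ α * Fintype.card ι)
    (hN : 16 ^ 16 * 2000 ≤ α * Fintype.card ι) :
    ∑ X : κ → ι → F, prodWeight (prodWeight p) X *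
      (if Module.finrank F (rowKer X) + Fintype.card κ = Fintype.card ι
        then fourierError ψ p (rowKer X) else 0) ≤
      (Real.exp 2 + 4) * Real.exp (-(α * Fintype.card ι / (16 ^ 16 * 2000))) := by
  set n := Fintype.card ι with hn_def
  set k := Fintype.card κ with hk_def
  set q : ℝ := (Fintype.card F : ℝ) with hq
  have hq0 : 0 < q := Nat.cast_pos.2 Fintype.card_pos
  have hn' : (1 : ℝ) ≤ n := by exact_mod_cast hn
  set u : ℝ := n * (α / 16 ^ 16) / 1000 with hu
  set ε : ℝ := Real.exp (-(lazyParam * α * n / 8)) with hε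
  set D : ℝ := Real.exp (-(α * n / (16 ^ 16 * 2000))) with hD
  let Z : Finset (ι → F) := Finset.univ.filter fun w => (n < 1000 * hammingNorm w ∧
    totalDefect ψ p w ≤ u) ∧
      prob (prodWeight p) (fun x : ι → F => x ⬝ᵥ w = 0) ≤ 2 ^ 11 / q
  have hW : IsProbVec (prodWeight (prodWeight p) : (κ → ι → F) → ℝ) := hp.prodWeight.prodWeight
  let sparse : (κ → ι → F) → Prop := fun X =>
    ∃ w ∈ rowKer X, w ≠ 0 ∧ 1000 * hammingNorm w ≤ n
  let bad : (κ → ι → F) → Prop := fun X =>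
    Module.finrank F (rowKer X) + k = n ∧ IsUnsaturated p ε (rowKer X)
  have hpoint : ∀ X : κ → ι → F, (if Module.finrank F (rowKer X) + k = n
      then fourierError ψ p (rowKer X) else 0) ≤ (if sparse X then 1 else 0) +
        (if bad X then 1 else 0) + (ε + Real.exp (-(u / 2))) +
        (q ^ (n - k))⁻¹ * ((Z.filter fun w => w ∈ rowKer X).card : ℝ) := by
    intro X
    have h0 : 0 ≤ (q ^ (n - k))⁻¹ * ((Z.filter fun w => w ∈ rowKer X).card : ℝ) := by positivity
    have h0' : 0 ≤ ε + Real.exp (-(u / 2)) := by positivity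
    have h1 : (0 : ℝ) ≤ if sparse X then 1 else 0 := by split_ifs <;> norm_num
    have h2 : (0 : ℝ) ≤ if bad X then 1 else 0 := by split_ifs <;> norm_num
    by_cases hX : Module.finrank F (rowKer X) + k = n
    · rw [if_pos hX]
      have hle1 := fourierError_le_one (ψ := ψ) hp (rowKer X)
      by_cases hs : sparse X
      · rw [if_pos hs]; linarith
      by_cases hb : bad X
      · rw [if_pos hb]; linarith
      rw [if_neg hs, if_neg hb]
      have hG : ∀ w ∈ rowKer X, w ≠ 0 → n < 1000 * hammingNorm w := fun w hw hw0 => by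
        by_contra hlt
        exact hs ⟨w, hw, hw0, not_lt.1 hlt⟩
      have h3 := fourierError_le_of_saturated hp hψ hα0 hα hn hN (Real.exp_pos _).le hG
        (fun h => hb ⟨hX, h⟩) u (Z := Z)
        (fun w h4 h5 h6 => Finset.mem_filter.2 ⟨Finset.mem_univ _, ⟨h4, h5⟩, h6⟩)
      have h4 : (Nat.card (rowKer X) : ℝ) = q ^ (n - k) := by
        rw [Nat.card_eq_fintype_card, Module.card_eq_pow_finrank (K := F), Nat.cast_pow]
        congr 1
        omega
      rw [h4] at h3
      linarith
    · rw [if_neg hX]; linarith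
  have hsum : ∑ X : κ → ι → F, prodWeight (prodWeight p) X *
      (if Module.finrank F (rowKer X) + k = n then fourierError ψ p (rowKer X) else 0) ≤
      prob (prodWeight (prodWeight p)) sparse + prob (prodWeight (prodWeight p)) bad +
        (ε + Real.exp (-(u / 2))) + (q ^ (n - k))⁻¹ * ∑ X : κ → ι → F,
          prodWeight (prodWeight p) X * ((Z.filter fun w => w ∈ rowKer X).card : ℝ) := by
    refine (Finset.sum_le_sum fun X _ => mul_le_mul_of_nonneg_left (hpoint X)
      (hW.nonneg X)).trans_eq ?_
    rw [prob_eq_sum_mul, prob_eq_sum_mul, Finset.mul_sum]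
    have e1 : ε + Real.exp (-(u / 2)) = ∑ X : κ → ι → F,
        prodWeight (prodWeight p) X * (ε + Real.exp (-(u / 2))) := by
      rw [← Finset.sum_mul, hW.sum_eq_one, one_mul]
    conv_rhs => rw [e1]
    rw [← Finset.sum_add_distrib, ← Finset.sum_add_distrib,
      ← Finset.sum_add_distrib]
    refine Finset.sum_congr rfl fun X _ => ?_
    ring
  have hαn : 0 ≤ α * n := by positivity
  have b1 : prob (prodWeight (prodWeight p)) sparse ≤ Real.exp 2 * D := by
    refine (prob_exists_sparse_le_exp (κ := κ) hp hψ hα0 hα1 hα hn hk hkn hlog).trans ?_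
    refine mul_le_mul_of_nonneg_left (Real.exp_le_exp.2 (neg_le_neg ?_)) (Real.exp_pos _).le
    exact div_le_div_of_nonneg_left hαn (by norm_num) (by norm_num)
  have b2 : prob (prodWeight (prodWeight p)) bad ≤ D := by
    refine (prob_unsaturated_le (κ := κ) hp hψ hα0 hα1 hα hn hN hkn).trans ?_
    refine Real.exp_le_exp.2 (neg_le_neg ?_)
    exact div_le_div_of_nonneg_left hαn (by norm_num) (by norm_num)
  have b3 : ε ≤ D := by
    refine Real.exp_le_exp.2 (neg_le_neg ?_)
    have : lazyParam * α * n / 8 = α * n / (4 * 16 ^ 11 * 8) := by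
      unfold lazyParam; field_simp
    rw [this]
    exact div_le_div_of_nonneg_left hαn (by norm_num) (by norm_num)
  have b4 : Real.exp (-(u / 2)) = D := by
    rw [hD, hu]; congr 2; field_simp; norm_num
  -- the powers of `q` cancel: `|Z| ≤ (c q) ^ n`, each of `k` rows contributes `2 ^ 11 / q`, and
  -- the average over the kernel contributes `q ^ (-(n - k))`
  have b5 : (q ^ (n - k))⁻¹ * ∑ X : κ → ι → F,
      prodWeight (prodWeight p) X * ((Z.filter fun w => w ∈ rowKer X).card : ℝ) ≤ D := by
    have h1 := sum_card_rowKer_inter_le (κ := κ) hp Z (ρ := 2 ^ 11 / q)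
      (fun w hw => (Finset.mem_filter.1 hw).2.2)
    have h2 : (Z.card : ℝ) ≤ (q * (Real.exp 1 * ((2 ^ 16)⁻¹ + Real.exp (-1000)))) ^ n := by
      refine le_trans ?_ (card_structured_le hp hψ hα0 hα 16)
      refine Nat.cast_le.2 (Finset.card_le_card fun w hw => ?_)
      exact Finset.mem_filter.2 ⟨Finset.mem_univ _, (Finset.mem_filter.1 hw).2.1⟩
    have h3 : (2 : ℝ) ^ 11 * (Real.exp 1 * ((2 ^ 16)⁻¹ + Real.exp (-1000))) ≤ Real.exp (-1) := by
      have h4 : Real.exp (-1000) ≤ (2 ^ 16)⁻¹ := by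
        rw [Real.exp_neg]
        refine inv_anti₀ (by positivity) ?_
        have h5 : Real.exp 1000 = Real.exp 1 ^ 1000 := by rw [← Real.exp_nat_mul]; norm_num
        rw [h5]
        exact (pow_le_pow_right₀ (by norm_num) (by norm_num : 16 ≤ 1000)).trans
          (pow_le_pow_left₀ (by norm_num) (by linarith [Real.add_one_le_exp 1]) 1000)
      have h6 := Real.exp_one_lt_d9
      have h7 := Real.exp_neg_one_gt_d9
      have h8 : Real.exp 1 * ((2 ^ 16)⁻¹ + Real.exp (-1000)) ≤ 2.72 * ((2 ^ 16)⁻¹ + (2 ^ 16)⁻¹) :=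
        mul_le_mul (by linarith) (by linarith) (by positivity) (by norm_num)
      norm_num at h8 h7 ⊢
      linarith
    have hqk : (q ^ (n - k))⁻¹ * (q ^ n * (q ^ k)⁻¹) = 1 := by
      have : q ^ n = q ^ (n - k) * q ^ k := by rw [← pow_add]; congr 1; omega
      rw [this]; field_simp
    calc _ ≤ (q ^ (n - k))⁻¹ * ((q * (Real.exp 1 * ((2 ^ 16)⁻¹ + Real.exp (-1000)))) ^ n *
          (2 ^ 11 / q) ^ k) := by
          refine mul_le_mul_of_nonneg_left (h1.trans ?_) (by positivity)
          exact mul_le_mul_of_nonneg_right h2 (by positivity)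
      _ = ((q ^ (n - k))⁻¹ * (q ^ n * (q ^ k)⁻¹)) * ((2 ^ 11) ^ k *
          (Real.exp 1 * ((2 ^ 16)⁻¹ + Real.exp (-1000))) ^ n) := by
        rw [mul_pow, div_pow]; ring
      _ ≤ 1 * ((2 ^ 11) ^ n * (Real.exp 1 * ((2 ^ 16)⁻¹ + Real.exp (-1000))) ^ n) := by
        rw [hqk]
        gcongr
        norm_num
      _ ≤ Real.exp (-1) ^ n := by
        rw [one_mul, ← mul_pow]
        exact pow_le_pow_left₀ (by positivity) h3 n
      _ ≤ D := by
        rw [← Real.exp_nat_mul]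
        refine Real.exp_le_exp.2 ?_
        have : α * n / (16 ^ 16 * 2000) ≤ n := by
          rw [div_le_iff₀ (by norm_num)]
          nlinarith
        linarith
  linarith

end Main

/-! ### Rank and determinant -/

section Rank

variable {F : Type*} [Field F] [Fintype F] [DecidableEq F] {ψ : AddChar F ℂ} {p : F → ℝ}

/-- The probability that `k` independent rows of length `n` are linearly independent. -/
noncomputable def fullRankProb (p : F → ℝ) (n k : ℕ) : ℝ :=
  prob (prodWeight (prodWeight p)) fun X : Fin k → Fin n → F =>
    Module.finrank F (rowKer X) + k = n

/-- One step of the rank chain. A new row increases the rank unless it is orthogonal to the common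
kernel, which a uniform row would be with probability `q ^ (-(n - k))`. -/
theorem fullRankProb_succ_sub_le (hp : IsProbVec p) (hψ : ψ ≠ 1) {α : ℝ} (hα0 : 0 < α)
    (hα1 : α < 1) (hα : DenseWeight α p) {n k : ℕ} (hn : 1 ≤ n) (hkn : k ≤ n)
    (hlog : 640 * Real.log n ≤ α * n) (hN : 16 ^ 16 * 2000 ≤ α * n) :
    |fullRankProb p n (k + 1) - fullRankProb p n k * (1 - ((Fintype.card F : ℝ) ^ (n - k))⁻¹)| ≤
      (Real.exp 2 + 4) * Real.exp (-(α * n / (16 ^ 16 * 2000))) := by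
  classical
  set q : ℝ := (Fintype.card F : ℝ) with hq
  have hq0 : 0 < q := Nat.cast_pos.2 Fintype.card_pos
  have hW : IsProbVec (prodWeight (prodWeight p) : (Fin k → Fin n → F) → ℝ) :=
    hp.prodWeight.prodWeight
  have hw := hp.prodWeight (κ := Fin n)
  have hstep : fullRankProb p n (k + 1) = ∑ Y : Fin k → Fin n → F, prodWeight (prodWeight p) Y *
      (if Module.finrank F (rowKer Y) + k = n
        then 1 - prob (prodWeight p) (fun z : Fin n → F => Kills z (rowKer Y)) else 0) := by
    rw [fullRankProb, prob_eq_sum_mul, sum_prodWeight_snoc]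
    refine Finset.sum_congr rfl fun Y _ => ?_
    congr 1
    have hiff := finrank_rowKer_snoc_iff Y
    simp only [Fintype.card_fin] at hiff
    simp only [hiff]
    split_ifs with hY
    · rw [← prob_not hw, prob_eq_sum_mul]
      simp [hY]
    · simp [hY]
  have hdiff : fullRankProb p n (k + 1) - fullRankProb p n k * (1 - (q ^ (n - k))⁻¹) =
      ∑ Y : Fin k → Fin n → F, prodWeight (prodWeight p) Y *
        (if Module.finrank F (rowKer Y) + k = n then (q ^ (n - k))⁻¹ -
          prob (prodWeight p) (fun z : Fin n → F => Kills z (rowKer Y)) else 0) := by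
    rw [hstep, fullRankProb, prob_eq_sum_mul, Finset.sum_mul, ← Finset.sum_sub_distrib]
    refine Finset.sum_congr rfl fun Y _ => ?_
    split_ifs <;> ring
  have hcard : ∀ Y : Fin k → Fin n → F, Module.finrank F (rowKer Y) + k = n →
      (Nat.card (rowKer Y) : ℝ) = q ^ (n - k) := by
    intro Y hY
    rw [Nat.card_eq_fintype_card, Module.card_eq_pow_finrank (K := F), Nat.cast_pow]
    congr 1
    omega
  rw [hdiff]
  refine (Finset.abs_sum_le_sum_abs _ _).trans ?_
  by_cases hk : n ≤ 2 * k
  · have h := sum_fourierError_le (ι := Fin n) (κ := Fin k) hp hψ hα0 hα1 hα (by simpa using hn)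
      (by simpa using hk) (by simpa using hkn) (by simpa using hlog) (by simpa using hN)
    simp only [Fintype.card_fin] at h
    refine le_trans (Finset.sum_le_sum fun Y _ => ?_) h
    rw [abs_mul, abs_of_nonneg (hW.nonneg Y)]
    refine mul_le_mul_of_nonneg_left ?_ (hW.nonneg Y)
    split_ifs with hY
    · rw [abs_sub_comm, ← hcard Y hY]
      exact abs_prob_kills_sub_le hp hψ _
    · simp
  · -- few rows: both the probability and its uniform value are at most `(1 - α) ^ (n - k)`
    have hn' : (0 : ℝ) < n := by exact_mod_cast hn
    have hqα : q⁻¹ ≤ 1 - α := by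
      rw [inv_le_iff_one_le_mul₀ hq0]
      calc (1 : ℝ) = ∑ y, p y := hp.sum_eq_one.symm
        _ ≤ ∑ _y : F, (1 - α) := Finset.sum_le_sum fun y _ => hα.apply_le y
        _ = (1 - α) * q := by rw [Finset.sum_const, Finset.card_univ, nsmul_eq_mul, mul_comm]
    have hexp : (1 - α) ^ (n - k) ≤ Real.exp (-(α * n / (16 ^ 16 * 2000))) := by
      have h1 : 1 - α ≤ Real.exp (-α) := by linarith [Real.add_one_le_exp (-α)]
      refine (pow_le_pow_left₀ (by linarith) h1 _).trans ?_
      rw [← Real.exp_nat_mul]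
      refine Real.exp_le_exp.2 ?_
      have h2 : (n : ℝ) / 2 ≤ ((n - k : ℕ) : ℝ) := by
        rw [div_le_iff₀ (by norm_num)]
        exact_mod_cast (by omega : n ≤ (n - k) * 2)
      have h3 : α * n / (16 ^ 16 * 2000) ≤ α * n / 2 :=
        div_le_div_of_nonneg_left (by positivity) (by norm_num) (by norm_num)
      nlinarith
    have hterm : ∀ Y : Fin k → Fin n → F, |prodWeight (prodWeight p) Y *
        (if Module.finrank F (rowKer Y) + k = n then (q ^ (n - k))⁻¹ -
          prob (prodWeight p) (fun z : Fin n → F => Kills z (rowKer Y)) else 0)| ≤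
        prodWeight (prodWeight p) Y * (1 - α) ^ (n - k) := by
      intro Y
      rw [abs_mul, abs_of_nonneg (hW.nonneg Y)]
      refine mul_le_mul_of_nonneg_left ?_ (hW.nonneg Y)
      split_ifs with hY
      · have h1 := prob_kills_le_pow hp hα.apply_le (rowKer Y)
        rw [show Module.finrank F (rowKer Y) = n - k by omega] at h1
        have h2 := prob_nonneg hw (fun z : Fin n → F => Kills z (rowKer Y))
        have h3 : (q ^ (n - k))⁻¹ ≤ (1 - α) ^ (n - k) := by
          rw [← inv_pow]
          exact pow_le_pow_left₀ (by positivity) hqα _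
        have h4 : 0 ≤ (q ^ (n - k))⁻¹ := by positivity
        rw [abs_le]
        constructor <;> linarith
      · rw [abs_zero]
        exact pow_nonneg (by linarith) _
    refine (Finset.sum_le_sum fun Y _ => hterm Y).trans ?_
    rw [← Finset.sum_mul, hW.sum_eq_one, one_mul]
    nlinarith [Real.exp_pos 2, Real.exp_pos (-(α * n / (16 ^ 16 * 2000)))]

omit [DecidableEq F] in
theorem one_sub_inv_card_pow_mem (j : ℕ) :
    0 ≤ 1 - ((Fintype.card F : ℝ) ^ j)⁻¹ ∧ 1 - ((Fintype.card F : ℝ) ^ j)⁻¹ ≤ 1 := by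
  have hq : (1 : ℝ) ≤ Fintype.card F := by exact_mod_cast Fintype.card_pos
  have h1 : ((Fintype.card F : ℝ) ^ j)⁻¹ ≤ 1 := inv_le_one_of_one_le₀ (one_le_pow₀ hq)
  have h2 : 0 ≤ ((Fintype.card F : ℝ) ^ j)⁻¹ := by positivity
  constructor <;> linarith

theorem fullRankProb_sub_prod_le (hp : IsProbVec p) (hψ : ψ ≠ 1) {α : ℝ} (hα0 : 0 < α)
    (hα1 : α < 1) (hα : DenseWeight α p) {n k : ℕ} (hn : 1 ≤ n) (hkn : k ≤ n)
    (hlog : 640 * Real.log n ≤ α * n) (hN : 16 ^ 16 * 2000 ≤ α * n) :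
    |fullRankProb p n k - ∏ j ∈ Finset.range k, (1 - ((Fintype.card F : ℝ) ^ (n - j))⁻¹)| ≤
      k * ((Real.exp 2 + 4) * Real.exp (-(α * n / (16 ^ 16 * 2000)))) := by
  induction k with
  | zero =>
    have h : fullRankProb p n 0 = 1 := by
      rw [fullRankProb, ← prob_true ((hp.prodWeight (κ := Fin n)).prodWeight (κ := Fin 0))]
      congr 1
      funext X
      have : rowKer X = ⊤ := by ext w; simp [mem_rowKer]
      rw [eq_iff_iff, this]
      simp
    simp [h]
  | succ k ih =>
    have h1 := ih (by omega)
    have h2 := fullRankProb_succ_sub_le hp hψ hα0 hα1 hα hn (by omega : k ≤ n) hlog hN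
    have h3 := one_sub_inv_card_pow_mem (F := F) (n - k)
    rw [Finset.prod_range_succ]
    set a := 1 - ((Fintype.card F : ℝ) ^ (n - k))⁻¹
    set e := (Real.exp 2 + 4) * Real.exp (-(α * n / (16 ^ 16 * 2000)))
    set L := ∏ j ∈ Finset.range k, (1 - ((Fintype.card F : ℝ) ^ (n - j))⁻¹)
    have h4 : fullRankProb p n (k + 1) - L * a =
        (fullRankProb p n (k + 1) - fullRankProb p n k * a) + (fullRankProb p n k - L) * a := by
      ring
    rw [h4]
    refine (abs_add_le _ _).trans ?_
    rw [abs_mul, abs_of_nonneg h3.1]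
    have h5 := mul_le_of_le_one_right (abs_nonneg (fullRankProb p n k - L)) h3.2
    push_cast
    linarith

/-- The vector of cofactors of the last row of a square matrix, as a function of the other rows. -/
noncomputable def cofactorVec {m : ℕ} (Y : Fin m → Fin (m + 1) → F) (j : Fin (m + 1)) : F :=
  (-1) ^ (m + (j : ℕ)) * ((Matrix.of Y).submatrix id j.succAbove).det

omit [Fintype F] [DecidableEq F] in
theorem det_snoc {m : ℕ} (Y : Fin m → Fin (m + 1) → F) (z : Fin (m + 1) → F) :
    (Matrix.of (Fin.snoc Y z : Fin (m + 1) → Fin (m + 1) → F)).det = z ⬝ᵥ cofactorVec Y := by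
  rw [Matrix.det_succ_row _ (Fin.last m), dotProduct]
  refine Finset.sum_congr rfl fun j _ => ?_
  have h : (Matrix.of (Fin.snoc Y z : Fin (m + 1) → Fin (m + 1) → F)).submatrix
      (Fin.last m).succAbove j.succAbove = (Matrix.of Y).submatrix id j.succAbove := by
    ext a b
    simp [Fin.succAbove_last]
  rw [h, cofactorVec, Fin.val_last, Matrix.of_apply, Fin.snoc_last]
  ring

omit [Fintype F] [DecidableEq F] in
theorem det_eq_zero_iff_rowKer {n : ℕ} (X : Fin n → Fin n → F) :
    (Matrix.of X).det = 0 ↔ ∃ w ∈ rowKer X, w ≠ 0 := by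
  rw [← Matrix.exists_mulVec_eq_zero_iff]
  constructor
  · rintro ⟨v, hv, h⟩
    exact ⟨v, fun j => congrFun h j, hv⟩
  · rintro ⟨v, h, hv⟩
    exact ⟨v, hv, funext fun j => h j⟩

omit [Fintype F] [DecidableEq F] in
theorem cofactorVec_mem_rowKer {m : ℕ} (Y : Fin m → Fin (m + 1) → F) :
    cofactorVec Y ∈ rowKer Y := by
  intro i
  rw [← det_snoc]
  refine Matrix.det_zero_of_row_eq (i := i.castSucc) (j := Fin.last m)
    (Fin.castSucc_lt_last i).ne ?_
  ext b
  simp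

omit [Fintype F] [DecidableEq F] in
theorem finrank_of_det_snoc_ne_zero {m : ℕ} {Y : Fin m → Fin (m + 1) → F} {z : Fin (m + 1) → F}
    (h : z ⬝ᵥ cofactorVec Y ≠ 0) : Module.finrank F (rowKer Y) + m = m + 1 := by
  rw [← det_snoc] at h
  have hbot : rowKer (Fin.snoc Y z : Fin (m + 1) → Fin (m + 1) → F) = ⊥ := by
    rw [Submodule.eq_bot_iff]
    intro w hw
    by_contra hw0
    exact h ((det_eq_zero_iff_rowKer _).2 ⟨w, hw, hw0⟩)
  have := (finrank_rowKer_snoc_iff Y z).1 (by rw [hbot]; simp)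
  simpa using this.1

omit [Fintype F] [DecidableEq F] in
theorem cofactorVec_ne_zero {m : ℕ} {Y : Fin m → Fin (m + 1) → F}
    (hY : Module.finrank F (rowKer Y) + m = m + 1) : cofactorVec Y ≠ 0 := by
  intro h0
  obtain ⟨w, hw0⟩ := Module.finrank_pos_iff_exists_ne_zero.1
    (by omega : 0 < Module.finrank F (rowKer Y))
  obtain ⟨i, hi⟩ := Function.ne_iff.1 (fun h => hw0 (Subtype.ext h) : w.1 ≠ 0)
  have hz : ¬ Kills (Pi.single i 1 : Fin (m + 1) → F) (rowKer Y) := by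
    intro hk
    have := hk w.1 w.2
    simp at this
    exact hi this
  have h1 := (finrank_rowKer_snoc_iff Y (Pi.single i 1)).2 ⟨by simpa using hY, hz⟩
  have hbot : rowKer (Fin.snoc Y (Pi.single i 1) : Fin (m + 1) → Fin (m + 1) → F) = ⊥ := by
    simpa using h1
  have h2 := det_snoc Y (Pi.single i 1)
  rw [h0, dotProduct_zero, det_eq_zero_iff_rowKer, hbot] at h2
  obtain ⟨v, hv, hv0⟩ := h2
  exact hv0 hv

/-- Given linearly independent other rows, the determinant takes the value `t` with probability
`1 / |F|`, up to the Fourier error of the common kernel of these rows. -/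
theorem abs_prob_dotProduct_cofactorVec_sub_le (hp : IsProbVec p) (hψ : ψ ≠ 1) {m : ℕ}
    {Y : Fin m → Fin (m + 1) → F} (hY : Module.finrank F (rowKer Y) + m = m + 1) (t : F) :
    |prob (prodWeight p) (fun z : Fin (m + 1) → F => z ⬝ᵥ cofactorVec Y = t) -
      (Fintype.card F : ℝ)⁻¹| ≤ fourierError ψ p (rowKer Y) := by
  classical
  have h := abs_prob_dotProduct_eq_sub_le hp hψ (cofactorVec Y) t
  refine h.trans ?_
  have hcard : (Nat.card (rowKer Y) : ℝ) = Fintype.card F := by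
    rw [Nat.card_eq_fintype_card, Module.card_eq_pow_finrank (K := F),
      show Module.finrank F (rowKer Y) = 1 by omega, pow_one]
  have hq0 : (0 : ℝ) < Fintype.card F := Nat.cast_pos.2 Fintype.card_pos
  rw [inv_mul_le_iff₀ hq0, ← hcard, card_mul_fourierError hp]
  let f : F → rowKer Y := fun a =>
    ⟨a • cofactorVec Y, (rowKer Y).smul_mem a (cofactorVec_mem_rowKer Y)⟩
  have hf : Function.Injective f := fun a b hab =>
    smul_left_injective F (cofactorVec_ne_zero hY) (congrArg Subtype.val hab)
  calc ∑ a ∈ Finset.univ.filter (fun a : F => a ≠ 0), ∏ i, ‖charFn ψ p (a * cofactorVec Y i)‖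
      = ∑ v ∈ (Finset.univ.filter (fun a : F => a ≠ 0)).image f,
          ∏ i, ‖charFn ψ p (v.1 i)‖ := by
        rw [Finset.sum_image fun a _ b _ h => hf h]
        rfl
    _ ≤ _ := by
      refine Finset.sum_le_sum_of_subset_of_nonneg ?_ fun v _ _ =>
        Finset.prod_nonneg fun i _ => norm_nonneg _
      intro v hv
      obtain ⟨a, ha, rfl⟩ := Finset.mem_image.1 hv
      refine Finset.mem_erase.2 ⟨fun h0 => (Finset.mem_filter.1 ha).2 ?_, Finset.mem_univ _⟩
      refine hf (h0.trans ?_)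
      exact Subtype.ext (zero_smul F _).symm

/-- The determinant is the inner product of the last row with the vector of cofactors. It can be
non-zero only if the other rows are linearly independent, and then the vector of cofactors is a
non-zero element of their common kernel. -/
theorem prob_det_sub_fullRankProb_le (hp : IsProbVec p) (hψ : ψ ≠ 1) {α : ℝ} (hα0 : 0 < α)
    (hα1 : α < 1) (hα : DenseWeight α p) {m : ℕ} (hm : 1 ≤ m)
    (hlog : 640 * Real.log (m + 1 : ℕ) ≤ α * (m + 1 : ℕ))
    (hN : 16 ^ 16 * 2000 ≤ α * (m + 1 : ℕ)) {t : F} (ht : t ≠ 0) :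
    |prob (prodWeight (prodWeight p)) (fun X : Fin (m + 1) → Fin (m + 1) → F =>
        (Matrix.of X).det = t) - (Fintype.card F : ℝ)⁻¹ * fullRankProb p (m + 1) m| ≤
      (Real.exp 2 + 4) * Real.exp (-(α * (m + 1 : ℕ) / (16 ^ 16 * 2000))) := by
  classical
  set q : ℝ := (Fintype.card F : ℝ) with hq
  have hW : IsProbVec (prodWeight (prodWeight p) : (Fin m → Fin (m + 1) → F) → ℝ) :=
    hp.prodWeight.prodWeight
  have hdiff : prob (prodWeight (prodWeight p)) (fun X : Fin (m + 1) → Fin (m + 1) → F =>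
      (Matrix.of X).det = t) - q⁻¹ * fullRankProb p (m + 1) m =
      ∑ Y : Fin m → Fin (m + 1) → F, prodWeight (prodWeight p) Y *
        (if Module.finrank F (rowKer Y) + m = m + 1 then
          prob (prodWeight p) (fun z : Fin (m + 1) → F => z ⬝ᵥ cofactorVec Y = t) - q⁻¹
          else 0) := by
    rw [fullRankProb, prob_eq_sum_mul, sum_prodWeight_snoc, prob_eq_sum_mul, Finset.mul_sum,
      ← Finset.sum_sub_distrib]
    refine Finset.sum_congr rfl fun Y _ => ?_
    simp only [det_snoc]
    rw [← prob_eq_sum_mul]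
    split_ifs with hY
    · ring
    · have : prob (prodWeight p) (fun z : Fin (m + 1) → F => z ⬝ᵥ cofactorVec Y = t) = 0 := by
        refine Finset.sum_eq_zero fun z _ => if_neg fun hz => hY ?_
        exact finrank_of_det_snoc_ne_zero (hz ▸ ht)
      rw [this]; ring
  rw [hdiff]
  refine (Finset.abs_sum_le_sum_abs _ _).trans ?_
  have h := sum_fourierError_le (ι := Fin (m + 1)) (κ := Fin m) hp hψ hα0 hα1 hα (by simp)
    (by simp; omega) (by simp) (by rw [Fintype.card_fin]; exact hlog)
    (by rw [Fintype.card_fin]; exact hN)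
  simp only [Fintype.card_fin] at h
  refine le_trans (Finset.sum_le_sum fun Y _ => ?_) h
  rw [abs_mul, abs_of_nonneg (hW.nonneg Y)]
  refine mul_le_mul_of_nonneg_left ?_ (hW.nonneg Y)
  split_ifs with hY
  · exact abs_prob_dotProduct_cofactorVec_sub_le hp hψ hY t
  · simp

end Rank

/-! ### The limiting product -/

section Product

variable {q : ℕ}

theorem prod_range_sub_prod_range_le (hq : 2 ≤ q) (m k : ℕ) :
    (0 ≤ ∏ i ∈ Finset.range (m + k), (1 - ((q : ℝ) ^ (i + 2))⁻¹)) ∧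
    (∏ i ∈ Finset.range (m + k), (1 - ((q : ℝ) ^ (i + 2))⁻¹) ≤
      ∏ i ∈ Finset.range m, (1 - ((q : ℝ) ^ (i + 2))⁻¹)) ∧
    (∏ i ∈ Finset.range m, (1 - ((q : ℝ) ^ (i + 2))⁻¹) -
      ∏ i ∈ Finset.range (m + k), (1 - ((q : ℝ) ^ (i + 2))⁻¹) ≤
        ((2 : ℝ) ^ (m + 1))⁻¹ - ((2 : ℝ) ^ (m + k + 1))⁻¹) := by
  have hq' : (2 : ℝ) ≤ q := by exact_mod_cast hq
  have hfac : ∀ i : ℕ, 0 ≤ 1 - ((q : ℝ) ^ (i + 2))⁻¹ ∧ 1 - ((q : ℝ) ^ (i + 2))⁻¹ ≤ 1 := by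
    intro i
    have h1 : ((q : ℝ) ^ (i + 2))⁻¹ ≤ 1 := inv_le_one_of_one_le₀ (one_le_pow₀ (by linarith))
    have h2 : 0 ≤ ((q : ℝ) ^ (i + 2))⁻¹ := by positivity
    constructor <;> linarith
  induction k with
  | zero => exact ⟨Finset.prod_nonneg fun i _ => (hfac i).1, le_rfl, by simp⟩
  | succ k ih =>
    obtain ⟨h0, h1, h2⟩ := ih
    rw [← add_assoc, Finset.prod_range_succ]
    set L := ∏ i ∈ Finset.range (m + k), (1 - ((q : ℝ) ^ (i + 2))⁻¹)
    have hL : L ≤ 1 := Finset.prod_le_one (fun i _ => (hfac i).1) fun i _ => (hfac i).2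
    have h3 : ((q : ℝ) ^ (m + k + 2))⁻¹ ≤ ((2 : ℝ) ^ (m + k + 2))⁻¹ :=
      inv_anti₀ (by positivity) (pow_le_pow_left₀ (by norm_num) hq' _)
    have h4 : 0 ≤ ((q : ℝ) ^ (m + k + 2))⁻¹ := by positivity
    have h5 : ((2 : ℝ) ^ (m + k + 1))⁻¹ = 2 * ((2 : ℝ) ^ (m + k + 2))⁻¹ := by
      rw [pow_succ _ (m + k + 1), mul_inv]; ring
    have h6 : ((2 : ℝ) ^ (m + k + 1 + 1))⁻¹ = ((2 : ℝ) ^ (m + k + 2))⁻¹ := rfl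
    refine ⟨mul_nonneg h0 (hfac _).1, ?_, ?_⟩
    · nlinarith
    · rw [h6]
      nlinarith

theorem prodFromTwo_bounds (hq : 2 ≤ q) (m : ℕ) :
    0 ≤ prodFromTwo q ∧
      prodFromTwo q ≤ ∏ i ∈ Finset.range m, (1 - ((q : ℝ) ^ (i + 2))⁻¹) ∧
      ∏ i ∈ Finset.range m, (1 - ((q : ℝ) ^ (i + 2))⁻¹) ≤
        prodFromTwo q + ((2 : ℝ) ^ (m + 1))⁻¹ := by
  have hlim : Filter.Tendsto
      (fun k => ∏ i ∈ Finset.range (m + k), (1 - ((q : ℝ) ^ (i + 2))⁻¹)) Filter.atTop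
      (nhds (prodFromTwo q)) := by
    have h := (multipliable_prodFromTwo hq).hasProd.tendsto_prod_nat
    have h2 := h.comp (Filter.tendsto_add_atTop_nat m)
    refine h2.congr fun k => ?_
    simp [add_comm]
  have h := prod_range_sub_prod_range_le hq m
  refine ⟨ge_of_tendsto' hlim fun k => (h k).1, le_of_tendsto' hlim fun k => (h k).2.1, ?_⟩
  rw [← sub_le_iff_le_add]
  refine ge_of_tendsto' hlim fun k => ?_
  have : 0 ≤ ((2 : ℝ) ^ (m + k + 1))⁻¹ := by positivity
  linarith [(h k).2.2]

end Product

/-! ### From random matrices to weights -/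

section Measure

variable {F : Type*} [Field F] [Fintype F] [MeasurableSpace F] [MeasurableSingletonClass F]
  {μ : Measure F} [IsProbabilityMeasure μ]

omit [Field F] in
theorem isProbVec_measureReal : IsProbVec fun y : F => μ.real {y} := by
  refine ⟨fun y => measureReal_nonneg, ?_⟩
  have h := sum_measureReal_singleton (μ := μ) (Finset.univ : Finset F)
  rw [h]
  simp

omit [Field F] in
theorem prob_measureReal (S : F → Prop) : prob (fun y : F => μ.real {y}) S = μ.real {y | S y} := by
  classical
  have h := sum_measureReal_singleton (μ := μ) (Finset.univ.filter S)
  simp only [Finset.coe_filter, Finset.mem_univ, true_and] at h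
  rw [← h, Finset.sum_filter]
  unfold prob
  exact Finset.sum_congr rfl fun x _ => by congr

theorem IsAlphaDense.denseWeight {α : ℝ} (h : IsAlphaDense α μ) :
    DenseWeight α fun y : F => μ.real {y} := by
  intro T hT s
  rw [prob_measureReal]
  refine le_trans (le_of_eq ?_) (h.2.2 T hT s)
  congr 1
  ext y
  simp only [Set.mem_ofPred_eq, Set.mem_image, SetLike.mem_coe]
  constructor
  · exact fun hy => ⟨y - s, hy, by abel⟩
  · rintro ⟨x, hx, rfl⟩
    simpa using hx

omit [IsProbabilityMeasure μ] in
theorem HasIIDEntries.measureReal_det_eq {Ω : Type*} [MeasurableSpace Ω] {P : Measure Ω}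
    [IsProbabilityMeasure P] {n : ℕ} {A : Ω → Matrix (Fin n) (Fin n) F}
    (hA : HasIIDEntries A μ P) (t : F) :
    P.real {ω | (A ω).det = t} = prob (prodWeight (prodWeight fun y : F => μ.real {y}))
      fun X : Fin n → Fin n → F => (Matrix.of X).det = t := by
  classical
  have hsing : ∀ i j y, MeasurableSet {ω | A ω i j = y} := fun i j y =>
    hA.measurable_entry i j (measurableSet_singleton y)
  have hset : ∀ X : Fin n → Fin n → F, {ω | A ω = Matrix.of X} =
      ⋂ ij ∈ (Finset.univ : Finset (Fin n × Fin n)),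
        (fun ω => A ω ij.1 ij.2) ⁻¹' {X ij.1 ij.2} := by
    intro X
    ext ω
    simp only [Set.mem_ofPred_eq, Set.mem_iInter, Finset.mem_univ, forall_true_left,
      Set.mem_preimage, Set.mem_singleton_iff, Prod.forall]
    exact ⟨fun h i j => by rw [h]; rfl, fun h => by ext i j; exact h i j⟩
  have hmeas : ∀ X : Fin n → Fin n → F, MeasurableSet {ω | A ω = Matrix.of X} := by
    intro X
    rw [hset]
    exact Finset.measurableSet_biInter _ fun ij _ => hsing ij.1 ij.2 _
  have hpt : ∀ X : Fin n → Fin n → F, P.real {ω | A ω = Matrix.of X} =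
      prodWeight (prodWeight fun y : F => μ.real {y}) X := by
    intro X
    have h := hA.indep_entries.measure_inter_preimage_eq_mul Finset.univ
      (sets := fun ij => {X ij.1 ij.2}) (fun ij _ => measurableSet_singleton _)
    rw [measureReal_def, hset, h, ENNReal.toReal_prod, Fintype.prod_prod_type]
    refine Finset.prod_congr rfl fun i _ => Finset.prod_congr rfl fun j _ => ?_
    change (P ((fun ω => A ω i j) ⁻¹' {X i j})).toReal = (μ {X i j}).toReal
    rw [← hA.law_entry i j, Measure.map_apply (hA.measurable_entry i j)
      (measurableSet_singleton _)]
  have hun : {ω | (A ω).det = t} = ⋃ X ∈ Finset.univ.filter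
      (fun X : Fin n → Fin n → F => (Matrix.of X).det = t), {ω | A ω = Matrix.of X} := by
    ext ω
    simp only [Set.mem_ofPred_eq, Finset.mem_filter, Finset.mem_univ, true_and, Set.mem_iUnion,
      exists_prop]
    exact ⟨fun h => ⟨A ω, h, rfl⟩, fun ⟨X, h, h'⟩ => by rw [h']; exact h⟩
  rw [hun, measureReal_biUnion_finset _ fun X _ => hmeas X]
  · rw [Finset.sum_filter]
    unfold prob
    refine Finset.sum_congr rfl fun X _ => ?_
    rw [hpt]
  · intro X _ X' _ hne
    refine Set.disjoint_left.2 fun ω h h' => hne ?_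
    have : Matrix.of X = Matrix.of X' := h.symm.trans h'
    exact Matrix.of.injective this

end Measure

theorem exists_addChar_ne_one (F : Type*) [Field F] [Fintype F] : ∃ ψ : AddChar F ℂ, ψ ≠ 1 := by
  refine ⟨AddChar.FiniteField.primitiveChar_to_Complex F, fun h => ?_⟩
  have := AddChar.FiniteField.primitiveChar_to_Complex_isPrimitive F (one_ne_zero)
  rw [AddChar.mulShift_one] at this
  exact this h

theorem mainTheorem2 :
    ∃ c : ℝ, 0 < c ∧ ∃ C : ℝ, 0 < C ∧ ∃ K : ℝ, 0 < K ∧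
      ∀ (F : Type*) [Field F] [Fintype F] [MeasurableSpace F] [MeasurableSingletonClass F]
        (Ω : Type*) [MeasurableSpace Ω] (P : Measure Ω) [IsProbabilityMeasure P]
        (α : ℝ) (μ : Measure F) [IsProbabilityMeasure μ] (n : ℕ)
        (A : Ω → Matrix (Fin n) (Fin n) F),
        IsAlphaDense α μ → HasIIDEntries A μ P → K * Real.log n ≤ α * n →
        ∀ t : F, t ≠ 0 →
          |P.real {ω | (A ω).det = t} -
              (Fintype.card F : ℝ)⁻¹ * prodFromTwo (Fintype.card F)| ≤
            C * Real.exp (-(c * α * n)) := by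
  refine ⟨1 / (16 ^ 16 * 4000), by positivity, Real.exp 2 + 5, by positivity, 16 ^ 16 * 4000,
    by positivity, ?_⟩
  intro F _ _ _ _ Ω _ P _ α μ _ n A hμ hA hlog t ht
  classical
  obtain ⟨ψ, hψ⟩ := exists_addChar_ne_one F
  have hq : 2 ≤ Fintype.card F := Fintype.one_lt_card
  set p : F → ℝ := fun y => μ.real {y} with hp_def
  have hp : IsProbVec p := isProbVec_measureReal
  have hα : DenseWeight α p := hμ.denseWeight
  have hα0 := hμ.1
  have hα1 := hμ.2.1
  set q : ℝ := (Fintype.card F : ℝ) with hqdef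
  have hq2 : (2 : ℝ) ≤ q := by rw [hqdef]; exact_mod_cast hq
  have hqinv0 : 0 ≤ q⁻¹ := by positivity
  have hqinv1 : q⁻¹ ≤ 1 := inv_le_one_of_one_le₀ (by linarith)
  have hb0 := prodFromTwo_bounds hq 0
  simp only [Finset.range_zero, Finset.prod_empty] at hb0
  by_cases hN : 16 ^ 16 * 2000 ≤ α * n
  · have hn0 : n ≠ 0 := by
      rintro rfl
      norm_num at hN
    have hn1 : n ≠ 1 := by
      rintro rfl
      norm_num at hN
      linarith
    obtain ⟨m, rfl⟩ : ∃ m, n = m + 1 := ⟨n - 1, by omega⟩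
    have hlog0 : 0 ≤ Real.log ((m + 1 : ℕ) : ℝ) := Real.log_natCast_nonneg _
    have hlog' : 640 * Real.log ((m + 1 : ℕ) : ℝ) ≤ α * (m + 1 : ℕ) := by
      refine le_trans ?_ hlog
      exact mul_le_mul_of_nonneg_right (by norm_num) hlog0
    rw [hA.measureReal_det_eq]
    have h1 := prob_det_sub_fullRankProb_le hp hψ hα0 hα1 hα (by omega : 1 ≤ m) hlog' hN ht
    have h2 := fullRankProb_sub_prod_le hp hψ hα0 hα1 hα (by omega : 1 ≤ m + 1)
      (by omega : m ≤ m + 1) hlog' hN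
    have h3 : ∏ j ∈ Finset.range m, (1 - (q ^ (m + 1 - j))⁻¹) =
        ∏ i ∈ Finset.range m, (1 - (q ^ (i + 2))⁻¹) := by
      rw [← Finset.prod_range_reflect]
      refine Finset.prod_congr rfl fun j hj => ?_
      have := Finset.mem_range.1 hj
      congr 3
      omega
    rw [h3] at h2
    have hb := prodFromTwo_bounds hq m
    set D := Real.exp (-(α * (m + 1 : ℕ) / (16 ^ 16 * 2000))) with hD
    set Dh := Real.exp (-(1 / (16 ^ 16 * 4000) * α * (m + 1 : ℕ))) with hDh
    set a := prob (prodWeight (prodWeight p)) (fun X : Fin (m + 1) → Fin (m + 1) → F =>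
        (Matrix.of X).det = t)
    set R := fullRankProb p (m + 1) m
    set Q := ∏ i ∈ Finset.range m, (1 - (q ^ (i + 2))⁻¹)
    set L := prodFromTwo (Fintype.card F)
    have hm : (0 : ℝ) < (m + 1 : ℕ) := by positivity
    have hDD : D = Dh * Dh := by
      rw [hD, hDh, ← Real.exp_add]
      congr 1
      field_simp
      norm_num
    have hDh0 : 0 < Dh := Real.exp_pos _
    -- the number of rows is absorbed into half of the exponent
    have hnD : ((m + 1 : ℕ) : ℝ) * Dh ≤ 1 := by
      have h4 : ((m + 1 : ℕ) : ℝ) ≤ Real.exp (1 / (16 ^ 16 * 4000) * α * (m + 1 : ℕ)) := by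
        rw [← Real.exp_log hm]
        refine Real.exp_le_exp.2 ?_
        rw [Real.exp_log hm]
        have : 1 / (16 ^ 16 * 4000) * α * ((m + 1 : ℕ) : ℝ) =
            (α * (m + 1 : ℕ)) / (16 ^ 16 * 4000) := by ring
        rw [this, le_div_iff₀ (by norm_num), mul_comm]
        exact hlog
      calc ((m + 1 : ℕ) : ℝ) * Dh ≤ Real.exp (1 / (16 ^ 16 * 4000) * α * (m + 1 : ℕ)) * Dh :=
            mul_le_mul_of_nonneg_right h4 hDh0.le
        _ = 1 := by rw [hDh, ← Real.exp_add]; simp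
    have h2m : ((2 : ℝ) ^ (m + 1))⁻¹ ≤ Dh := by
      rw [hDh, Real.exp_neg]
      refine inv_anti₀ (Real.exp_pos _) ?_
      have h5 : Real.exp (1 / (16 ^ 16 * 4000) * α * (m + 1 : ℕ)) ≤
          Real.exp ((m + 1 : ℕ) * (1 / 2)) := by
        refine Real.exp_le_exp.2 ?_
        have : 1 / (16 ^ 16 * 4000) * α ≤ 1 / 2 := by norm_num; linarith
        nlinarith
      refine h5.trans ?_
      rw [Real.exp_nat_mul]
      refine pow_le_pow_left₀ (Real.exp_pos _).le ?_ _
      have h6 : Real.exp (1 / 2) ^ 2 = Real.exp 1 := by rw [← Real.exp_nat_mul]; norm_num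
      have h7 := Real.exp_one_lt_d9
      nlinarith [Real.exp_pos (1 / 2)]
    have e1 : |q⁻¹ * (R - Q)| ≤ m * ((Real.exp 2 + 4) * D) := by
      rw [abs_mul, abs_of_nonneg hqinv0]
      exact (mul_le_of_le_one_left (abs_nonneg _) hqinv1).trans h2
    have e2 : |q⁻¹ * (Q - L)| ≤ Dh := by
      rw [abs_mul, abs_of_nonneg hqinv0]
      refine (mul_le_of_le_one_left (abs_nonneg _) hqinv1).trans ?_
      rw [abs_of_nonneg (by linarith [hb.2.1])]
      linarith [hb.2.2]
    have e3 : a - q⁻¹ * L = (a - q⁻¹ * R) + q⁻¹ * (R - Q) + q⁻¹ * (Q - L) := by ring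
    rw [e3]
    refine (abs_add_le _ _).trans ((add_le_add (abs_add_le _ _) le_rfl).trans ?_)
    have e4 : (Real.exp 2 + 4) * D + m * ((Real.exp 2 + 4) * D) =
        (Real.exp 2 + 4) * (((m + 1 : ℕ) : ℝ) * Dh * Dh) := by
      rw [hDD]; push_cast; ring
    have e5 : ((m + 1 : ℕ) : ℝ) * Dh * Dh ≤ Dh := by
      simpa using mul_le_mul_of_nonneg_right hnD hDh0.le
    have e6 := mul_le_mul_of_nonneg_left e5 (by positivity : 0 ≤ Real.exp 2 + 4)
    linarith
  · -- for bounded `α * n` the right-hand side exceeds `1`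
    have h1 : |P.real {ω | (A ω).det = t} - q⁻¹ * prodFromTwo (Fintype.card F)| ≤ 1 := by
      have h2 : P.real {ω | (A ω).det = t} ≤ 1 := measureReal_le_one
      have h3 : 0 ≤ P.real {ω | (A ω).det = t} := measureReal_nonneg
      have h4 : 0 ≤ q⁻¹ * prodFromTwo (Fintype.card F) := mul_nonneg hqinv0 hb0.1
      have h5 : q⁻¹ * prodFromTwo (Fintype.card F) ≤ 1 := mul_le_one₀ hqinv1 hb0.1 hb0.2.1
      rw [abs_le]
      constructor <;> linarith
    refine h1.trans ?_
    have h2 : (1 / 2 : ℝ) ≤ Real.exp (-(1 / (16 ^ 16 * 4000) * α * n)) := by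
      have h3 := Real.add_one_le_exp (-(1 / (16 ^ 16 * 4000) * α * n))
      have h4 : 1 / (16 ^ 16 * 4000) * α * n ≤ 1 / 2 := by
        push Not at hN
        norm_num at hN ⊢
        linarith
      linarith
    nlinarith [Real.exp_pos 2]
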